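/- **Definitions.** Let $R=\begin{pmatrix}1&1\\1&0\end{pmatrix}$, and let $R_k=R^{\otimes k}$ be its $k$-fold Kronecker power, the $N\times N$ disjointness matrix with $N=2^k$. Rows and columns of $R^{\otimes d}$ are identified with subsets of $[d]$, so that $R^{\otimes d}_{S,T}=1$ if $S\cap T=\emptyset$ and $0$ otherwise. A *partitioning* of a $0/1$ matrix $M\in\{0,1\}^{I\times J}$ is a finite family of rectangles $I_i\times J_i$ ($I_i\subseteq I$, $J_i\subseteq J$) with $M=\sum_i \mathbb 1_{I_i}\mathbb 1_{J_i}^{\mathsf T}$. Its $\alpha$-volume is $\sum_i|I_i|^{\alpha}|J_i|^{1-\alpha}$. Let $\mathrm{Size}_{\mathsf{PAR}}(M)$ be the minimum of $\sum_i(|I_i|+|J_i|)$ over all partitionings of $M$, and $\sigma_{\mathsf{PAR}}(M)=\lim_{n\to\infty}\mathrm{Size}_{\mathsf{PAR}}(M^{\otimes n})^{1/n}$. A *depth-$d$ linear circuit* over a field $\mathbb F$ computing $M$ is a factorization $M=A_1A_2\cdots A_d$ into matrices over $\mathbb F$; its size is $\sum_j \mathrm{nnz}(A_j)$, where $\mathrm{nnz}$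 counts nonzero entries. *Merging procedure.* Let $w$ be a word in the letters $\mathtt R,\mathtt C,\mathtt R^+,\mathtt C^+$ with a number $a_i$ attached to every letter $w_i\in\{\mathtt R^+,\mathtt C^+\}$. Start with $r=c=0$ and the empty family of rectangles, and read $w$ from left to right. * At $\mathtt R$: for every $S\subseteq[d]$ with $|S|=r$ add the rectangle with the single row $S$ and columns $\{T: T\cap S=\emptyset,\ |T|\ge c\}$; then increase $r$ by $1$. * At $\mathtt R^+$ with number $a$: choose sets $S_1,\dots,S_a\subseteq[d]$ of size $r+1$ with $|S_j\cap S_k|<r$ for all $j\ne k$ (if none exist, the procedure fails). For each $j$ add the rectangle with rows $\{S\subseteq S_j:|S|\ge r\}$ and columns $\{T:T\cap S_j=\emptyset,\ |T|\ge c\}$. For every $S$ that either has size $r+1$ and is none of the $S_j$, or has size $r$ and is contained in no $S_j$, add the rectangle with the single row $S$ and columns $\{T:T\cap S=\emptyset,\ |T|\ge c\}$. For every $S$ of size $r$ contained in some $S_j$ add the rectangle with the single row $S$ and columns $\{T:T\cap S=\emptyset,\ T\cap S_j\neq\emptyset,\ |T|\ge c\}$. Then increase $r$ by $2$. * At $\mathtt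 C$ and $\mathtt C^+$: do the same with the roles of rows and columns, and of $r$ and $c$, exchanged. The output is the resulting family $I_{w,a}$ of rectangles, and $\rho_{w,a}(\alpha)$ denotes its $\alpha$-volume. Fix $d=18$ and $$w=\mathtt{R\,C\,R^+C^+R^+C^+R^+C^+R\,C\,R\,C\,R},\qquad a=(-,-,9,9,198,198,1260,1260,-,-,-,-,-).$$ **Theorem.** For this $w$ and $a$ the choices in the merging procedure can be made so that it does not fail, and for all admissible choices the output $I_{w,a}$ is a partitioning of $R^{\otimes 18}$. The limit defining $\sigma_{\mathsf{PAR}}(R)$ exists, and for all admissible choices $$\sigma_{\mathsf{PAR}}(R)\le\rho_{w,a}(1/2)^{1/18}<2^{1.249424}.$$ Consequently there is an absolute constant $K$ such that over any field, for all $k\ge 0$ and $N=2^k$, the matrix $R_k$ has a depth-2 linear circuit of size at most $K\,N^{1.249424}$. For every even $d\ge 2$ there is a constant $K_d$, depending only on $d$, such that over any field, for all $k\ge0$ and $N=2^k$, the matrix $R_k$ has a depth-$d$ linear circuit of size at most $K_d\,N^{1+0.498848/d}$. -/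

import Mathlib

open Filter Topology

universe u

/-! ### Matrices and Kronecker powers -/

/-- The `2 × 2` disjointness matrix `R`, with entries `0, 1` taken in `α`. -/
def disjointnessMatrix (α : Type*) [Zero α] [One α] : Matrix (Fin 2) (Fin 2) α :=
  !![1, 1; 1, 0]

/-- The `k`-fold Kronecker power of a matrix; rows and columns are indexed by `k`-tuples, and
the entry at a pair of tuples is the product of the entries at their coordinates. -/
def kroneckerPower {I J α : Type*} [CommSemiring α] (M : Matrix I J α) (k : ℕ) :
    Matrix (Fin k → I) (Fin k → J) α :=
  Matrix.of fun i j => ∏ t, M (i t) (j t)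

/-- The number of nonzero entries of a (finite) matrix. -/
noncomputable def nnz {I J α : Type*} [Zero α] (M : Matrix I J α) : ℕ :=
  {p : I × J | M p.1 p.2 ≠ 0}.ncard

/-! ### Linear circuits of depth `d` -/

/-- A synchronous linear circuit of depth `d` over `F` with inputs `J` and outputs `I`: a sequence
of `d` matrices `A₁, …, A_d` of compatible formats, where the layers strictly between
the outputs and the inputs consist of finitely many gates. -/
inductive LinearCircuit (F J : Type*) : Type → ℕ → Type _
  | last {I : Type} (A : Matrix I J F) : LinearCircuit F J I 1
  | cons {I : Type} {g d : ℕ} (A : Matrix I (Fin g) F) (C : LinearCircuit F J (Fin g) d) :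
      LinearCircuit F J I (d + 1)

namespace LinearCircuit

/-- The matrix `A₁ * ⋯ * A_d` computed by a circuit. -/
def matrix {F J : Type*} [Semiring F] : {I : Type} → {d : ℕ} → LinearCircuit F J I d → Matrix I J F
  | _, _, .last A => A
  | _, _, .cons A C => A * C.matrix

/-- The size (number of wires) `nnz A₁ + ⋯ + nnz A_d` of a circuit. -/
noncomputable def size {F J : Type*} [Zero F] : {I : Type} → {d : ℕ} → LinearCircuit F J I d → ℕ
  | _, _, .last A => nnz A
  | _, _, .cons A C => nnz A + C.size

end LinearCircuit

/-! ### Partitions into rectangles -/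

/-- A rectangle: a set of rows and a set of columns. -/
abbrev Rectangle (I J : Type*) := Finset I × Finset J

/-- A finite family of rectangles is a partitioning of the binary matrix `M` if `M` is
the sum of the indicator matrices of the rectangles. -/
def IsPartitioning {I J : Type*} [DecidableEq I] [DecidableEq J]
    (P : Multiset (Rectangle I J)) (M : Matrix I J ℕ) : Prop :=
  ∀ i j, (P.map fun Q => if i ∈ Q.1 ∧ j ∈ Q.2 then 1 else 0).sum = M i j

/-- The partitioning size of a binary matrix: the minimum of `∑ (|I_i| + |J_i|)` over all
partitionings. -/
noncomputable def sizePAR {I J : Type*} [DecidableEq I] [DecidableEq J] (M : Matrix I J ℕ) : ℕ :=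
  sInf {s | ∃ P : Multiset (Rectangle I J), IsPartitioning P M ∧
    (P.map fun Q => Q.1.card + Q.2.card).sum = s}

/-- The asymptotic partitioning size `lim_n sizePAR (M^{⊗ n}) ^ (1 / n)`. -/
noncomputable def sigmaPAR {I J : Type*} [DecidableEq I] [DecidableEq J] (M : Matrix I J ℕ) : ℝ :=
  limUnder atTop fun n : ℕ => (sizePAR (kroneckerPower M n) : ℝ) ^ (1 / (n : ℝ))

/-- The `α`-volume `∑ |I_i| ^ α * |J_i| ^ (1 - α)` of a family of rectangles. -/
noncomputable def alphaVolume {I J : Type*} (P : Multiset (Rectangle I J)) (α : ℝ) : ℝ :=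
  (P.map fun Q => (Q.1.card : ℝ) ^ α * (Q.2.card : ℝ) ^ (1 - α)).sum

/-! ### The merging procedure

Rows and columns of `R^{⊗ d}` are identified with subsets of `Fin d`. -/

/-- The `0/1`-vector of a subset of `Fin d`, which indexes a row or column of `R^{⊗ d}`. -/
def indicatorTuple {d : ℕ} (S : Finset (Fin d)) : Fin d → Fin 2 :=
  fun t => if t ∈ S then 1 else 0

/-- For each `S` of size `r`: the row `S` with the columns `T` disjoint from `S`, `|T| ≥ c`. -/
def rowRects (d r c : ℕ) : Multiset (Rectangle (Finset (Fin d)) (Finset (Fin d))) :=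
  (Finset.univ.filter fun S : Finset (Fin d) => S.card = r).val.map fun S =>
    ({S}, Finset.univ.filter fun T => Disjoint T S ∧ c ≤ T.card)

/-- An admissible choice for a merging step: `a` sets of size `r + 1` any two of which meet in
fewer than `r` points. -/
def IsPacking {d : ℕ} (r a : ℕ) (𝒮 : Finset (Finset (Fin d))) : Prop :=
  𝒮.card = a ∧ (∀ S ∈ 𝒮, S.card = r + 1) ∧
    ∀ S ∈ 𝒮, ∀ S' ∈ 𝒮, S ≠ S' → (S ∩ S').card < r

/-- The rectangles of a row merging step with chosen sets `𝒮`. -/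
def rowMergeRects (d r c : ℕ) (𝒮 : Finset (Finset (Fin d))) :
    Multiset (Rectangle (Finset (Fin d)) (Finset (Fin d))) :=
  -- each chosen set together with its subsets of size `r`, with their common columns
  (𝒮.val.map fun S' =>
    (Finset.univ.filter fun S => S ⊆ S' ∧ r ≤ S.card,
      Finset.univ.filter fun T => Disjoint T S' ∧ c ≤ T.card))
  -- the sets of size `r + 1` or `r` that were not merged
  + ((Finset.univ.filter fun S : Finset (Fin d) =>
      (S.card = r + 1 ∧ S ∉ 𝒮) ∨ (S.card = r ∧ ∀ S' ∈ 𝒮, ¬ S ⊆ S')).val.map fun S =>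
    ({S}, Finset.univ.filter fun T => Disjoint T S ∧ c ≤ T.card))
  -- the remaining columns of the merged sets of size `r`
  + (𝒮.val.bind fun S' => (Finset.univ.filter fun S => S ⊆ S' ∧ S.card = r).val.map fun S =>
    ({S}, Finset.univ.filter fun T => Disjoint T S ∧ ¬ Disjoint T S' ∧ c ≤ T.card))

/-- Exchange of the roles of rows and columns in a family of rectangles. -/
def swapRects {I J : Type*} (P : Multiset (Rectangle I J)) : Multiset (Rectangle J I) :=
  P.map Prod.swap

/-- The letters `R`, `C`, `R⁺`, `C⁺`; the merging letters carry the number of sets to be chosen. -/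
inductive Letter
  | row
  | col
  | rowMerge (a : ℕ)
  | colMerge (a : ℕ)

/-- `MergeRun d w r c P`: started with the counters `r` and `c`, the (nondeterministic) procedure
can process the word `w` without failure and output the family `P` of rectangles. -/
inductive MergeRun (d : ℕ) : List Letter → ℕ → ℕ →
    Multiset (Rectangle (Finset (Fin d)) (Finset (Fin d))) → Prop
  | nil (r c : ℕ) : MergeRun d [] r c 0
  | row {w r c P} (h : MergeRun d w (r + 1) c P) :
      MergeRun d (.row :: w) r c (rowRects d r c + P)
  | col {w r c P} (h : MergeRun d w r (c + 1) P) :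
      MergeRun d (.col :: w) r c (swapRects (rowRects d c r) + P)
  | rowMerge {w r c P a} (𝒮 : Finset (Finset (Fin d))) (h𝒮 : IsPacking r a 𝒮)
      (h : MergeRun d w (r + 2) c P) :
      MergeRun d (.rowMerge a :: w) r c (rowMergeRects d r c 𝒮 + P)
  | colMerge {w r c P a} (𝒮 : Finset (Finset (Fin d))) (h𝒮 : IsPacking c a 𝒮)
      (h : MergeRun d w r (c + 2) P) :
      MergeRun d (.colMerge a :: w) r c (swapRects (rowMergeRects d c r 𝒮) + P)

/-- The word `R C R⁺ C⁺ R⁺ C⁺ R⁺ C⁺ R C R C R` with the numbers `9, 9, 198, 198, 1260, 1260`. -/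
def mergeWord : List Letter :=
  [.row, .col, .rowMerge 9, .colMerge 9, .rowMerge 198, .colMerge 198, .rowMerge 1260,
    .colMerge 1260, .row, .col, .row, .col, .row]

open scoped Kronecker

/-! ### Kronecker powers -/

/-! A partitioning is a factorization: the row sides and the column sides of its rectangles form two
0/1 matrices. A partitioning over the natural numbers is thus a depth-two circuit over every field
with the same size, and the constants do not depend on the field. Products of rectangles make
`sizePAR` submultiplicative on Kronecker powers, so Fekete's lemma gives the limit `sigmaPAR`, and
it remains to bound it.

Plain tensor powers of one partitioning produce lopsided rectangles, for which the sum of the sides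
is far larger than the geometric mean. Hence the next factor is chosen for each rectangle
separately. The potential `powNorm ε a b` dominates both sides of an `a × b` rectangle. Refining the
rectangle by a partitioning `P` of the `d`-th power multiplies its potential by at most `exp (ε * B
^ 2)` times the `p`-volume of `P`, where `p = a ^ ε / (a ^ ε + b ^ ε)`. If every weight `p` admits a
partitioning of `p`-volume at most `V`, then `n → ∞` followed by `ε → 0` gives `sigmaPAR ≤ V ^ (1 /
d)` (`sigmaPAR_le_of_forall_alphaVolume_le`).

Here `V` is the `1 / 2`-volume of the output of the merging procedure. For `1 / 2 ≤ p ≤ 6 / 11` the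
output itself suffices, by convexity of the volume in the weight; for `p ≥ 6 / 11` the partitioning
into rows does; for `p < 1 / 2` the matrix is transposed
(`exists_isPartitioning_alphaVolume_le_half`). The output is a partitioning because each letter
covers exactly the disjoint pairs of the sizes it passes, and its volume depends only on the word
since distinct packing sets share no `r`-subset. The packings are nine disjoint pairs, an explicit
list of 198 quadruples, and 1260 sextuples obtained by matching colours of subsets of two halves of
nine points.

For even depth, the exponents are split into `d / 2` blocks and `A ⊗ B = (A ⊗ 1) * (1 ⊗ B)` is used:
each block pays the excess exponent only on its own share of the coordinates. -/

theorem kroneckerPower_append {I J α : Type*} [CommSemiring α] (M : Matrix I J α) (m n : ℕ) :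
    (kroneckerPower M (m + n)).submatrix (Fin.appendEquiv m n) (Fin.appendEquiv m n) =
      kroneckerPower M m ⊗ₖ kroneckerPower M n := by
  ext ⟨i, i'⟩ ⟨j, j'⟩
  simp [kroneckerPower, Fin.prod_univ_add, Fin.appendEquiv, Matrix.kroneckerMap_apply]

theorem kroneckerPower_map {I J α β : Type*} [CommSemiring α] [CommSemiring β] (f : α →+* β)
    (M : Matrix I J α) (k : ℕ) : (kroneckerPower M k).map f = kroneckerPower (M.map f) k := by
  ext i j
  simp [kroneckerPower]

theorem disjointnessMatrix_map {α β : Type*} [Semiring α] [Semiring β] (f : α →+* β) :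
    (disjointnessMatrix α).map f = disjointnessMatrix β := by
  ext i j
  fin_cases i <;> fin_cases j <;> simp [disjointnessMatrix]

/-! ### Operations on linear circuits -/

theorem nnz_submatrix {I J I' J' α : Type*} [Zero α] (M : Matrix I J α) (e : I' ≃ I) (f : J' ≃ J) :
    nnz (M.submatrix e f) = nnz M := by
  unfold nnz
  rw [← Nat.card_coe_set_eq, ← Nat.card_coe_set_eq]
  refine Nat.card_congr ((e.prodCongr f).subtypeEquiv fun p => ?_)
  simp

theorem nnz_kronecker_one {I J X α : Type*} [Semiring α] [Nontrivial α] [DecidableEq X]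
    (M : Matrix I J α) : nnz (M ⊗ₖ (1 : Matrix X X α)) = nnz M * Nat.card X := by
  unfold nnz
  rw [← Nat.card_coe_set_eq, ← Nat.card_coe_set_eq, ← Nat.card_prod]
  refine Nat.card_congr
    { toFun := fun p => (⟨(p.1.1.1, p.1.2.1), ?_⟩, p.1.1.2)
      invFun := fun q => ⟨((q.1.1.1, q.2), (q.1.1.2, q.2)), ?_⟩
      left_inv := ?_
      right_inv := ?_ }
  · have := p.2
    simp only [Set.mem_ofPred_eq, Matrix.kroneckerMap_apply] at this ⊢
    exact left_ne_zero_of_mul this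
  · simp only [Set.mem_ofPred_eq, Matrix.kroneckerMap_apply, Matrix.one_apply_eq, mul_one]
    exact q.1.2
  · rintro ⟨⟨⟨i, x⟩, ⟨j, y⟩⟩, h⟩
    simp only [Set.mem_ofPred_eq, Matrix.kroneckerMap_apply] at h
    have hxy : x = y := by
      by_contra hne
      exact right_ne_zero_of_mul h (Matrix.one_apply_ne hne)
    subst hxy
    rfl
  · rintro ⟨⟨⟨i, j⟩, h⟩, x⟩
    rfl

namespace LinearCircuit

variable {F J : Type*} [Field F]

theorem exists_reindex {I : Type} {d : ℕ} (C : LinearCircuit F J I d) {J' : Type*} {I' : Type}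
    (e : I' ≃ I) (f : J' ≃ J) :
    ∃ C' : LinearCircuit F J' I' d, C'.matrix = C.matrix.submatrix e f ∧ C'.size = C.size := by
  induction C generalizing I' with
  | last A => exact ⟨.last (A.submatrix e f), rfl, nnz_submatrix A e f⟩
  | cons A C ih =>
    obtain ⟨C', hC', hs⟩ := ih (Equiv.refl _)
    refine ⟨.cons (A.submatrix e (Equiv.refl _)) C', ?_, ?_⟩
    · simp only [matrix, hC']
      exact Matrix.submatrix_mul_equiv A C.matrix e (Equiv.refl _) f
    · simp only [size, hs, nnz_submatrix]

theorem exists_tensor_one {I : Type} {d : ℕ} (C : LinearCircuit F J I d) (X : Type) [Fintype X]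
    [DecidableEq X] :
    ∃ C' : LinearCircuit F (J × X) (I × X) d,
      C'.matrix = C.matrix ⊗ₖ (1 : Matrix X X F) ∧
      C'.size = C.size * Fintype.card X := by
  induction C with
  | last A =>
    exact ⟨.last (A ⊗ₖ (1 : Matrix X X F)), rfl, by simp [size, nnz_kronecker_one]⟩
  | @cons I g d A C ih =>
    obtain ⟨C', hC', hs⟩ := ih
    -- Inner layers have to be indexed by some `Fin g`, so the product layer is renumbered.
    let e : Fin (Fintype.card (Fin g × X)) ≃ Fin g × X := (Fintype.equivFin _).symm
    obtain ⟨C'', hC'', hs'⟩ := exists_reindex C' e (Equiv.refl _)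
    refine ⟨.cons ((A ⊗ₖ (1 : Matrix X X F)).submatrix (Equiv.refl _) e) C'', ?_, ?_⟩
    · simp only [matrix]
      rw [hC'', Matrix.submatrix_mul_equiv, hC', ← Matrix.mul_kronecker_mul]
      simp
    · simp only [size]
      rw [hs', hs, nnz_submatrix, nnz_kronecker_one, add_mul]
      simp

theorem exists_mul {I : Type} {d e g : ℕ} (C : LinearCircuit F (Fin g) I d)
    (D : LinearCircuit F J (Fin g) e) :
    ∃ E : LinearCircuit F J I (e + d),
      E.matrix = C.matrix * D.matrix ∧ E.size = C.size + D.size := by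
  induction C with
  | last A => exact ⟨.cons A D, rfl, rfl⟩
  | cons A C ih =>
    obtain ⟨E, hE, hs⟩ := ih
    exact ⟨.cons A E, by simp only [matrix, hE, Matrix.mul_assoc],
      by simp only [size, hs, add_assoc]⟩

/-- The circuit realizes `A ⊗ B = (A ⊗ 1) * (1 ⊗ B)`. Tensoring with an identity matrix copies each
wire once per index, which gives the two size factors. -/
theorem exists_kronecker {I I' J J' : Type} [Fintype I'] [Fintype J]
    {d e : ℕ} (C : LinearCircuit F J I d) (D : LinearCircuit F J' I' e) :
    ∃ E : LinearCircuit F (J × J') (I × I') (e + d),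
      E.matrix = C.matrix ⊗ₖ D.matrix ∧
      E.size = C.size * Fintype.card I' + D.size * Fintype.card J := by
  classical
  obtain ⟨C', hC, hCs⟩ := exists_tensor_one C I'
  obtain ⟨D', hD, hDs⟩ := exists_tensor_one D J
  let φ : Fin (Fintype.card (J × I')) ≃ J × I' := (Fintype.equivFin _).symm
  obtain ⟨C₁, hC₁, hCs₁⟩ := exists_reindex C' (Equiv.refl _) φ
  obtain ⟨D₁, hD₁, hDs₁⟩ := exists_reindex D' (φ.trans (Equiv.prodComm _ _)) (Equiv.prodComm J J')
  obtain ⟨E, hE, hEs⟩ := exists_mul C₁ D₁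
  refine ⟨E, ?_, by rw [hEs, hCs₁, hDs₁, hCs, hDs]⟩
  have h : D₁.matrix =
      ((1 : Matrix J J F) ⊗ₖ D.matrix).submatrix φ (Equiv.refl _) := by
    rw [hD₁, hD]
    ext x ⟨j, j'⟩
    simp [Matrix.kroneckerMap_apply, Matrix.one_apply, mul_comm]
  rw [hE, hC₁, h, Matrix.submatrix_mul_equiv, hC,
    ← Matrix.mul_kronecker_mul]
  simp

end LinearCircuit

/-- Depth-two circuits for the Kronecker powers of a matrix give circuits of any even depth. -/
theorem exists_circuit_even_depth {F : Type u} [Field F] (M : Matrix (Fin 2) (Fin 2) F)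
    {K β : ℝ} (hK : 0 ≤ K) (hβ : 0 ≤ β)
    (hM : ∀ k : ℕ, ∃ C : LinearCircuit F (Fin k → Fin 2) (Fin k → Fin 2) 2,
      C.matrix = kroneckerPower M k ∧ (C.size : ℝ) ≤ K * ((2 : ℝ) ^ k) ^ (1 + β))
    (m : ℕ) : ∀ h k : ℕ, k ≤ (h + 1) * m →
    ∃ C : LinearCircuit F (Fin k → Fin 2) (Fin k → Fin 2) (2 * (h + 1)),
      C.matrix = kroneckerPower M k ∧
      (C.size : ℝ) ≤ (h + 1) * (K * (2 : ℝ) ^ k * ((2 : ℝ) ^ m) ^ β) := by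
  -- The excess factor `(2 ^ k) ^ β` is replaced by its value at the block length `m`, so that all
  -- blocks obey a common bound.
  have hM' : ∀ k ≤ m, ∃ C : LinearCircuit F (Fin k → Fin 2) (Fin k → Fin 2) 2,
      C.matrix = kroneckerPower M k ∧ (C.size : ℝ) ≤ K * (2 : ℝ) ^ k * ((2 : ℝ) ^ m) ^ β := by
    intro k hk
    obtain ⟨C, hC, hs⟩ := hM k
    refine ⟨C, hC, hs.trans ?_⟩
    rw [Real.rpow_add (by positivity), Real.rpow_one, ← mul_assoc]
    gcongr
    norm_num
  intro h
  induction h with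
  | zero =>
    intro k hk
    obtain ⟨C, hC, hs⟩ := hM' k (by simpa using hk)
    exact ⟨C, hC, by simpa using hs⟩
  | succ h ih =>
    intro k hk
    -- One block of length at most `m` is split off. For `k ≤ m` the rest is the zeroth power, which
    -- keeps the depth equal to `2 * (h + 2)`.
    obtain ⟨a, b, rfl, ha, hb⟩ : ∃ a b, k = a + b ∧ a ≤ m ∧ b ≤ (h + 1) * m := by
      rcases le_total k m with hkm | hkm
      · exact ⟨k, 0, rfl, hkm, Nat.zero_le _⟩
      · exact ⟨m, k - m, by omega, le_rfl, by rw [add_mul] at hk; omega⟩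
    obtain ⟨C, hC, hCs⟩ := hM' a ha
    obtain ⟨D, hD, hDs⟩ := ih b hb
    obtain ⟨E, hE, hEs⟩ := LinearCircuit.exists_kronecker C D
    obtain ⟨E', hE', hEs'⟩ := E.exists_reindex (Fin.appendEquiv a b).symm (Fin.appendEquiv a b).symm
    refine ⟨E', ?_, ?_⟩
    · rw [hE', hE, hC, hD, ← kroneckerPower_append]
      simp
    · rw [hEs', hEs]
      simp only [Fintype.card_pi, Fintype.card_fin, Finset.prod_const, Finset.card_univ,
        Nat.cast_add, Nat.cast_mul, Nat.cast_pow, Nat.cast_ofNat, Nat.cast_one]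
      calc (C.size : ℝ) * 2 ^ b + D.size * 2 ^ a
          ≤ K * (2 : ℝ) ^ a * ((2 : ℝ) ^ m) ^ β * 2 ^ b
            + (h + 1) * (K * (2 : ℝ) ^ b * ((2 : ℝ) ^ m) ^ β) * 2 ^ a := by gcongr
        _ = _ := by rw [pow_add]; ring

/-- A partitioning of the natural number version of a matrix is a depth-two circuit over any
field. -/
theorem IsPartitioning.exists_circuit {F : Type u} [Field F] {I J : Type} [DecidableEq I]
    [DecidableEq J] {P : Multiset (Rectangle I J)} {M : Matrix I J ℕ} (hP : IsPartitioning P M) :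
    ∃ C : LinearCircuit F J I 2, C.matrix = M.map (Nat.castRingHom F) ∧
      C.size = (P.map fun Q => Q.1.card + Q.2.card).sum := by
  obtain ⟨L, rfl⟩ := Quot.exists_rep P
  refine ⟨.cons (g := L.length) (Matrix.of fun i t => if i ∈ (L.get t).1 then 1 else 0)
    (.last (Matrix.of fun t j => if j ∈ (L.get t).2 then 1 else 0)), ?_, ?_⟩
  · ext i j
    have := hP i j
    simp only [Multiset.quot_mk_to_coe'', Multiset.map_coe, Multiset.sum_coe] at this
    rw [Matrix.map_apply, ← this, LinearCircuit.matrix, LinearCircuit.matrix, Matrix.mul_apply]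
    conv_rhs => rw [← List.ofFn_get L]
    rw [List.map_ofFn, List.sum_ofFn, map_sum]
    refine Finset.sum_congr rfl fun t _ => ?_
    by_cases h1 : i ∈ (L.get t).1 <;> by_cases h2 : j ∈ (L.get t).2 <;> simp_all
  · simp only [Multiset.quot_mk_to_coe'', Multiset.map_coe, Multiset.sum_coe, LinearCircuit.size]
    conv_rhs => rw [← List.ofFn_get L]
    rw [List.map_ofFn, List.sum_ofFn]
    simp only [Function.comp_apply, Finset.sum_add_distrib]
    congr 1
    · have : {p : I × Fin L.length | (Matrix.of fun i t => if i ∈ (L.get t).1 then (1 : F) else 0)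
          p.1 p.2 ≠ 0} = ↑((Finset.univ.sigma fun t => (L.get t).1).map
            ((Equiv.sigmaEquivProd _ _).trans (Equiv.prodComm _ _)).toEmbedding) := by
        ext ⟨i, t⟩
        simp [Equiv.sigmaEquivProd]
      rw [nnz, this, Set.ncard_coe_finset, Finset.card_map, Finset.card_sigma]
    · have : {p : Fin L.length × J | (Matrix.of fun t j => if j ∈ (L.get t).2 then (1 : F) else 0)
          p.1 p.2 ≠ 0} = ↑((Finset.univ.sigma fun t => (L.get t).2).map
            (Equiv.sigmaEquivProd _ _).toEmbedding) := by
        ext ⟨t, j⟩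
        simp [Equiv.sigmaEquivProd]
      rw [nnz, this, Set.ncard_coe_finset, Finset.card_map, Finset.card_sigma]

/-! ### Products of rectangles -/

/-- The product of a rectangle in the `m`-th and one in the `n`-th power. -/
def appendRect {I J : Type*} {m n : ℕ} (Q : Rectangle (Fin m → I) (Fin m → J))
    (Q' : Rectangle (Fin n → I) (Fin n → J)) : Rectangle (Fin (m + n) → I) (Fin (m + n) → J) :=
  ((Q.1 ×ˢ Q'.1).map (Fin.appendEquiv m n).toEmbedding,
    (Q.2 ×ˢ Q'.2).map (Fin.appendEquiv m n).toEmbedding)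

theorem card_appendRect_fst {I J : Type*} {m n : ℕ} (Q : Rectangle (Fin m → I) (Fin m → J))
    (Q' : Rectangle (Fin n → I) (Fin n → J)) :
    (appendRect Q Q').1.card = Q.1.card * Q'.1.card := by
  simp [appendRect]

theorem card_appendRect_snd {I J : Type*} {m n : ℕ} (Q : Rectangle (Fin m → I) (Fin m → J))
    (Q' : Rectangle (Fin n → I) (Fin n → J)) :
    (appendRect Q Q').2.card = Q.2.card * Q'.2.card := by
  simp [appendRect]

theorem kroneckerPower_zero_or_one {I J : Type*} {M : Matrix I J ℕ}
    (hM : ∀ i j, M i j = 0 ∨ M i j = 1) (n : ℕ)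
    (i : Fin n → I) (j : Fin n → J) : kroneckerPower M n i j = 0 ∨ kroneckerPower M n i j = 1 := by
  by_cases h : ∃ t, M (i t) (j t) = 0
  · obtain ⟨t, ht⟩ := h
    exact .inl (Finset.prod_eq_zero (Finset.mem_univ t) ht)
  · push Not at h
    right
    change ∏ t, M (i t) (j t) = 1
    exact Finset.prod_eq_one fun t _ => (hM _ _).resolve_left (h t)

/-! ### Products of partitionings and existence of the limit. -/

section

variable {I J : Type*} [DecidableEq I] [DecidableEq J]

/-- The second factor `T Q` may vary with the rectangle `Q`: the entries of `Q` are all 1, and each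
is replaced by a copy of the `n`-th power that can be partitioned independently. The balancing
argument rests on this freedom. -/
theorem IsPartitioning.bind_append {m n : ℕ} {M : Matrix I J ℕ}
    {P : Multiset (Rectangle (Fin m → I) (Fin m → J))} (hP : IsPartitioning P (kroneckerPower M m))
    {T : Rectangle (Fin m → I) (Fin m → J) → Multiset (Rectangle (Fin n → I) (Fin n → J))}
    (hT : ∀ Q, IsPartitioning (T Q) (kroneckerPower M n)) :
    IsPartitioning (P.bind fun Q => (T Q).map (appendRect Q)) (kroneckerPower M (m + n)) := by
  intro i j
  obtain ⟨⟨i₁, i₂⟩, rfl⟩ := (Fin.appendEquiv m n).surjective i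
  obtain ⟨⟨j₁, j₂⟩, rfl⟩ := (Fin.appendEquiv m n).surjective j
  have h := congrFun (congrFun (kroneckerPower_append M m n) (i₁, i₂)) (j₁, j₂)
  rw [Matrix.submatrix_apply, Matrix.kroneckerMap_apply] at h
  rw [h, ← hP i₁ j₁, Multiset.map_bind, Multiset.sum_bind, ← Multiset.sum_map_mul_right]
  congr 1
  refine Multiset.map_congr rfl fun Q _ => ?_
  rw [Multiset.map_map, ← hT Q i₂ j₂, ← Multiset.sum_map_mul_left]
  congr 1
  refine Multiset.map_congr rfl fun Q' _ => ?_
  have h1 : Fin.appendEquiv m n (i₁, i₂) ∈ (appendRect Q Q').1 ↔ i₁ ∈ Q.1 ∧ i₂ ∈ Q'.1 := by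
    rw [appendRect, Finset.mem_map_equiv]; simp
  have h2 : Fin.appendEquiv m n (j₁, j₂) ∈ (appendRect Q Q').2 ↔ j₁ ∈ Q.2 ∧ j₂ ∈ Q'.2 := by
    rw [appendRect, Finset.mem_map_equiv]; simp
  simp only [Function.comp_apply, h1, h2, ← ite_and, mul_ite, mul_one, mul_zero]
  congr 1
  exact propext (by tauto)

theorem exists_isPartitioning [Fintype I] [Fintype J] (M : Matrix I J ℕ)
    (hM : ∀ i j, M i j = 0 ∨ M i j = 1) : ∃ P, IsPartitioning P M := by
  refine ⟨(Finset.univ.filter fun p : I × J => M p.1 p.2 = 1).val.map fun p => ({p.1}, {p.2}), ?_⟩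
  intro i j
  rw [Multiset.map_map]
  change ∑ p ∈ Finset.univ.filter (fun p : I × J => M p.1 p.2 = 1), _ = _
  rw [Finset.sum_filter, Finset.sum_eq_single (i, j)]
  · rcases hM i j with h | h <;> simp [h]
  · rintro ⟨a, b⟩ _ hne
    simp only [Function.comp_apply, Finset.mem_singleton]
    split_ifs with h1 h2
    · exact absurd (Prod.ext h2.1.symm h2.2.symm) hne
    · rfl
    · rfl
  · simp

theorem sizePAR_le {M : Matrix I J ℕ} {P : Multiset (Rectangle I J)} (hP : IsPartitioning P M) :
    sizePAR M ≤ (P.map fun Q => Q.1.card + Q.2.card).sum :=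
  Nat.sInf_le ⟨P, hP, rfl⟩

theorem exists_isPartitioning_sizePAR {M : Matrix I J ℕ} (h : ∃ P, IsPartitioning P M) :
    ∃ P, IsPartitioning P M ∧ (P.map fun Q => Q.1.card + Q.2.card).sum = sizePAR M := by
  obtain ⟨P, hP⟩ := h
  exact Nat.sInf_mem (s := {s | ∃ P : Multiset (Rectangle I J), IsPartitioning P M ∧
    (P.map fun Q => Q.1.card + Q.2.card).sum = s}) ⟨_, P, hP, rfl⟩

theorem sizePAR_pos {M : Matrix I J ℕ} (h : ∃ P, IsPartitioning P M) (hM : ∃ i j, M i j ≠ 0) :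
    0 < sizePAR M := by
  obtain ⟨P, hP, hs⟩ := exists_isPartitioning_sizePAR h
  obtain ⟨i, j, hij⟩ := hM
  rw [← hs, Nat.pos_iff_ne_zero]
  intro h0
  refine hij ?_
  rw [← hP i j, Multiset.sum_eq_zero_iff]
  intro x hx
  obtain ⟨Q, hQ, rfl⟩ := Multiset.mem_map.1 hx
  have := (Multiset.sum_eq_zero_iff.1 h0) _ (Multiset.mem_map_of_mem _ hQ)
  rw [if_neg]
  rintro ⟨h1, -⟩
  have := Finset.card_pos.2 ⟨i, h1⟩
  omega

/-- Product rectangles suffice, since `x * x' + y * y' ≤ (x + y) * (x' + y')`. -/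
theorem sizePAR_append_le {M : Matrix I J ℕ} (h : ∀ n, ∃ P, IsPartitioning P (kroneckerPower M n))
    (m n : ℕ) :
    sizePAR (kroneckerPower M (m + n)) ≤
      sizePAR (kroneckerPower M m) * sizePAR (kroneckerPower M n) := by
  obtain ⟨P, hP, hs⟩ := exists_isPartitioning_sizePAR (h m)
  obtain ⟨P', hP', hs'⟩ := exists_isPartitioning_sizePAR (h n)
  refine (sizePAR_le (hP.bind_append (T := fun _ => P') fun _ => hP')).trans ?_
  rw [← hs, ← hs', Multiset.map_bind, Multiset.sum_bind, ← Multiset.sum_map_mul_right]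
  refine Multiset.sum_map_le_sum_map _ _ fun Q _ => ?_
  rw [Multiset.map_map, ← Multiset.sum_map_mul_left]
  refine Multiset.sum_map_le_sum_map _ _ fun Q' _ => ?_
  simp only [Function.comp_apply, card_appendRect_fst, card_appendRect_snd]
  nlinarith [Nat.zero_le (Q.1.card * Q'.2.card), Nat.zero_le (Q.2.card * Q'.1.card)]

/-- The limit defining `sigmaPAR` exists (Fekete's lemma). -/
theorem tendsto_sigmaPAR {M : Matrix I J ℕ} (h : ∀ n, ∃ P, IsPartitioning P (kroneckerPower M n))
    (hM : ∃ i j, M i j ≠ 0) :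
    Tendsto (fun n : ℕ => (sizePAR (kroneckerPower M n) : ℝ) ^ (1 / (n : ℝ))) atTop
      (𝓝 (sigmaPAR M)) := by
  have hpos : ∀ n, 0 < sizePAR (kroneckerPower M n) := by
    intro n
    obtain ⟨i, j, hij⟩ := hM
    exact sizePAR_pos (h n) ⟨fun _ => i, fun _ => j, by simp [kroneckerPower, hij]⟩
  have hsub : Subadditive fun n => Real.log (sizePAR (kroneckerPower M n)) := by
    intro m n
    rw [← Real.log_mul (by exact_mod_cast (hpos m).ne') (by exact_mod_cast (hpos n).ne')]
    refine Real.log_le_log (by exact_mod_cast hpos _) ?_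
    exact_mod_cast sizePAR_append_le h m n
  have hlim := hsub.tendsto_lim ⟨0, by
    rintro _ ⟨n, rfl⟩
    exact div_nonneg (Real.log_natCast_nonneg _) (Nat.cast_nonneg _)⟩
  have hexp : Tendsto (fun n : ℕ => (sizePAR (kroneckerPower M n) : ℝ) ^ (1 / (n : ℝ))) atTop
      (𝓝 (Real.exp hsub.lim)) := by
    refine ((Real.continuous_exp.tendsto _).comp hlim).congr fun n => ?_
    rw [Function.comp_apply, Real.rpow_def_of_pos (by exact_mod_cast hpos n), mul_one_div]
  rw [sigmaPAR, hexp.limUnder_eq]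
  exact hexp

end

/-! ### Balancing rectangles with a potential function -/

/-- The `ε`-power sum norm of the pair `(a, b)`, a smooth majorant of `max a b`. -/
noncomputable def powNorm (ε a b : ℝ) : ℝ := (a ^ ε + b ^ ε) ^ ε⁻¹

theorem le_powNorm_left {ε a b : ℝ} (hε : 0 < ε) (ha : 0 ≤ a) (hb : 0 ≤ b) :
    a ≤ powNorm ε a b := by
  calc a = (a ^ ε) ^ ε⁻¹ := by rw [← Real.rpow_mul ha, mul_inv_cancel₀ hε.ne', Real.rpow_one]
    _ ≤ _ := by
      unfold powNorm
      gcongr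
      exact le_add_of_nonneg_right (Real.rpow_nonneg hb _)

theorem le_powNorm_right {ε a b : ℝ} (hε : 0 < ε) (ha : 0 ≤ a) (hb : 0 ≤ b) :
    b ≤ powNorm ε a b := by
  have := le_powNorm_left hε hb ha
  rwa [powNorm, add_comm] at this

/-- Multiplying the sides of a rectangle by `x` and `y` multiplies its potential by a weighted
geometric mean of `x` and `y`, up to a factor that tends to `1` with `ε`. -/
theorem powNorm_mul_le {ε a b p q B x y : ℝ} (hε : 0 < ε) (hp : 0 ≤ p) (hq : 0 ≤ q)
    (hpq : p + q = 1) (hab : 0 < a ^ ε + b ^ ε) (ha : 0 ≤ a) (hb : 0 ≤ b)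
    (hpa : p * (a ^ ε + b ^ ε) = a ^ ε) (hqb : q * (a ^ ε + b ^ ε) = b ^ ε)
    (hx : 1 ≤ x) (hy : 1 ≤ y) (hxB : Real.log x ≤ B) (hyB : Real.log y ≤ B) (hB : ε * B ≤ 1) :
    powNorm ε (a * x) (b * y) ≤ powNorm ε a b * (Real.exp (ε * B ^ 2) * (x ^ p * y ^ q)) := by
  have hx0 : 0 < x := by linarith
  have hy0 : 0 < y := by linarith
  -- Second-order bound `exp u ≤ 1 + u + u ^ 2` for `u = ε * log z`, valid for `|u| ≤ 1`; this is
  -- where `ε * B ≤ 1` enters.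
  have key : ∀ z : ℝ, 1 ≤ z → Real.log z ≤ B →
      z ^ ε ≤ 1 + ε * Real.log z + ε ^ 2 * B ^ 2 := by
    intro z hz hzB
    have h0 : 0 ≤ Real.log z := Real.log_nonneg hz
    have h1 : ε * Real.log z ≤ ε * B := by gcongr
    have h2 := Real.abs_exp_sub_one_sub_id_le (x := ε * Real.log z)
      (by rw [abs_of_nonneg (by positivity)]; linarith)
    have h3 : (ε * Real.log z) ^ 2 ≤ (ε * B) ^ 2 := by gcongr
    rw [Real.rpow_def_of_pos (by linarith), mul_comm]
    have := (abs_le.1 h2).2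
    nlinarith
  -- Passing to an exponential makes the later `ε⁻¹`-th power exact: the arithmetic mean of powers
  -- becomes the geometric mean times `exp (ε * B ^ 2)`.
  have hmean : p * x ^ ε + q * y ^ ε ≤
      Real.exp (ε * (p * Real.log x + q * Real.log y + ε * B ^ 2)) := by
    calc p * x ^ ε + q * y ^ ε
        ≤ p * (1 + ε * Real.log x + ε ^ 2 * B ^ 2) + q * (1 + ε * Real.log y + ε ^ 2 * B ^ 2) := by
          gcongr
          · exact key x hx hxB
          · exact key y hy hyB
      _ = ε * (p * Real.log x + q * Real.log y + ε * B ^ 2) + 1 := by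
          linear_combination (1 + ε ^ 2 * B ^ 2) * hpq
      _ ≤ _ := Real.add_one_le_exp _
  have hsplit : (a * x) ^ ε + (b * y) ^ ε = (a ^ ε + b ^ ε) * (p * x ^ ε + q * y ^ ε) := by
    rw [Real.mul_rpow ha hx0.le, Real.mul_rpow hb hy0.le]
    linear_combination (-x ^ ε) * hpa - y ^ ε * hqb
  unfold powNorm
  rw [hsplit, Real.mul_rpow hab.le (by positivity)]
  gcongr
  calc (p * x ^ ε + q * y ^ ε) ^ ε⁻¹
      ≤ (Real.exp (ε * (p * Real.log x + q * Real.log y + ε * B ^ 2))) ^ ε⁻¹ := by gcongr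
    _ = Real.exp (p * Real.log x + q * Real.log y + ε * B ^ 2) := by
        rw [← Real.exp_mul]
        congr 1
        field_simp
    _ = _ := by
        rw [Real.rpow_def_of_pos hx0, Real.rpow_def_of_pos hy0, ← Real.exp_add, ← Real.exp_add]
        congr 1
        ring

section

variable {I J : Type*} [DecidableEq I] [DecidableEq J]

/-- Induction on `n`: every rectangle is refined by a partitioning adapted to its own shape, and the
total potential grows by a factor of at most `exp (ε * B ^ 2) * V` each time. -/
theorem exists_isPartitioning_powNorm_le {M : Matrix I J ℕ} {d : ℕ} {V ε B : ℝ} (hε : 0 < ε)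
    (hV : 0 ≤ V)
    (hIB : ∀ S : Finset (Fin d → I), Real.log S.card ≤ B)
    (hJB : ∀ S : Finset (Fin d → J), Real.log S.card ≤ B) (hB : ε * B ≤ 1)
    (hM : ∀ p : ℝ, 0 ≤ p → p ≤ 1 → ∃ P, IsPartitioning P (kroneckerPower M d) ∧
      (∀ Q ∈ P, Q.1.Nonempty ∧ Q.2.Nonempty) ∧ alphaVolume P p ≤ V) (n : ℕ) :
    ∃ P, IsPartitioning P (kroneckerPower M (d * n)) ∧ (∀ Q ∈ P, Q.1.Nonempty ∧ Q.2.Nonempty) ∧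
      (P.map fun Q => powNorm ε Q.1.card Q.2.card).sum ≤
        2 ^ ε⁻¹ * (Real.exp (ε * B ^ 2) * V) ^ n := by
  induction n with
  | zero =>
    -- The zeroth power is a `1 × 1` matrix; its single rectangle has potential `2 ^ ε⁻¹`.
    refine ⟨{({fun t => t.elim0}, {fun t => t.elim0})}, ?_, ?_, ?_⟩
    · intro i j
      simp only [Multiset.map_singleton, Multiset.sum_singleton, Finset.mem_singleton]
      rw [if_pos ⟨funext fun t => t.elim0, funext fun t => t.elim0⟩]
      simp [kroneckerPower]
    · simp
    · simp [powNorm, one_add_one_eq_two]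
  | succ n ih =>
    obtain ⟨P, hP, hne, hs⟩ := ih
    have hex : ∀ Q : Rectangle (Fin (d * n) → I) (Fin (d * n) → J),
        ∃ T : Multiset (Rectangle (Fin d → I) (Fin d → J)),
        IsPartitioning T (kroneckerPower M d) ∧ (∀ Q ∈ T, Q.1.Nonempty ∧ Q.2.Nonempty) ∧
        (Q.1.Nonempty ∧ Q.2.Nonempty →
          (T.map fun Q' => powNorm ε (appendRect Q Q').1.card (appendRect Q Q').2.card).sum ≤
            Real.exp (ε * B ^ 2) * V * powNorm ε Q.1.card Q.2.card) := by
      intro Q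
      by_cases hQ : Q.1.Nonempty ∧ Q.2.Nonempty
      · have ha : (0 : ℝ) < Q.1.card := by exact_mod_cast hQ.1.card_pos
        have hb : (0 : ℝ) < Q.2.card := by exact_mod_cast hQ.2.card_pos
        set a : ℝ := (Q.1.card : ℝ)
        set b : ℝ := (Q.2.card : ℝ)
        have ha' : 0 < a ^ ε := Real.rpow_pos_of_pos ha _
        have hb' : 0 < b ^ ε := Real.rpow_pos_of_pos hb _
        -- The weight is the share of the row side in the potential. The longer side gets the larger
        -- weight, so its further growth is penalized more.
        obtain ⟨T, hT, hTne, hTV⟩ := hM (a ^ ε / (a ^ ε + b ^ ε)) (by positivity)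
          (div_le_one_of_le₀ (by linarith) (by positivity))
        refine ⟨T, hT, hTne, fun _ => ?_⟩
        calc _ ≤ (T.map fun Q' => powNorm ε a b * Real.exp (ε * B ^ 2) *
                  ((Q'.1.card : ℝ) ^ (a ^ ε / (a ^ ε + b ^ ε)) *
                  (Q'.2.card : ℝ) ^ (1 - a ^ ε / (a ^ ε + b ^ ε)))).sum := by
              refine Multiset.sum_map_le_sum_map _ _ fun Q' hQ' => ?_
              rw [card_appendRect_fst, card_appendRect_snd, Nat.cast_mul, Nat.cast_mul, mul_assoc]
              refine powNorm_mul_le hε (by positivity) ?_ (by ring) (by positivity) ha.le hb.le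
                (div_mul_cancel₀ _ (by positivity))
                (by rw [sub_mul, div_mul_cancel₀ _ (by positivity)]; ring) ?_ ?_ (hIB _) (hJB _) hB
              · rw [sub_nonneg]
                exact div_le_one_of_le₀ (by linarith) (by positivity)
              · exact_mod_cast (hTne Q' hQ').1.card_pos
              · exact_mod_cast (hTne Q' hQ').2.card_pos
          _ = powNorm ε a b * Real.exp (ε * B ^ 2) * alphaVolume T (a ^ ε / (a ^ ε + b ^ ε)) := by
              rw [Multiset.sum_map_mul_left, alphaVolume]
          _ ≤ powNorm ε a b * Real.exp (ε * B ^ 2) * V := by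
              have : 0 ≤ powNorm ε a b := ha.le.trans (le_powNorm_left hε ha.le hb.le)
              gcongr
          _ = _ := by ring
      -- Empty rectangles do not occur in `P`; any partitioning serves as a value of the choice
      -- function there.
      · obtain ⟨T, hT, hTne, -⟩ := hM 0 le_rfl zero_le_one
        exact ⟨T, hT, hTne, fun h => absurd h hQ⟩
    choose T hT hTne hTs using hex
    refine ⟨P.bind fun Q => (T Q).map (appendRect Q), hP.bind_append hT, ?_, ?_⟩
    · intro Q hQ
      obtain ⟨Q₁, hQ₁, hQ⟩ := Multiset.mem_bind.1 hQ
      obtain ⟨Q₂, hQ₂, rfl⟩ := Multiset.mem_map.1 hQ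
      have h1 := hne Q₁ hQ₁
      have h2 := hTne Q₁ Q₂ hQ₂
      exact ⟨by simpa [appendRect] using ⟨h1.1, h2.1⟩, by simpa [appendRect] using ⟨h1.2, h2.2⟩⟩
    · rw [Multiset.map_bind, Multiset.sum_bind]
      calc _ ≤ (P.map fun Q => Real.exp (ε * B ^ 2) * V * powNorm ε Q.1.card Q.2.card).sum := by
            refine Multiset.sum_map_le_sum_map _ _ fun Q hQ => ?_
            rw [Multiset.map_map]
            exact hTs Q (hne Q hQ)
        _ ≤ Real.exp (ε * B ^ 2) * V * (2 ^ ε⁻¹ * (Real.exp (ε * B ^ 2) * V) ^ n) := by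
            rw [Multiset.sum_map_mul_left]
            gcongr
        _ = _ := by ring

/-- If for every weight `p` some partitioning of the `d`-th power has `p`-volume at most `V`, then
`V ^ (1 / d)` bounds the asymptotic partitioning size. -/
theorem sigmaPAR_le_of_forall_alphaVolume_le [Fintype I] [Fintype J] {M : Matrix I J ℕ} {d : ℕ}
    (hd : 0 < d) {V : ℝ}
    (hV : 0 < V)
    (hlim : Tendsto (fun n : ℕ => (sizePAR (kroneckerPower M n) : ℝ) ^ (1 / (n : ℝ))) atTop
      (𝓝 (sigmaPAR M)))
    (hM : ∀ p : ℝ, 0 ≤ p → p ≤ 1 → ∃ P, IsPartitioning P (kroneckerPower M d) ∧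
      (∀ Q ∈ P, Q.1.Nonempty ∧ Q.2.Nonempty) ∧ alphaVolume P p ≤ V) :
    sigmaPAR M ≤ V ^ (1 / (d : ℝ)) := by
  have hd0 : (0 : ℝ) < d := by exact_mod_cast hd
  -- Any bound independent of `n` and `ε` will do, since its effect vanishes as `ε → 0`.
  obtain ⟨B, hB0, hIB, hJB⟩ : ∃ B : ℝ, 0 < B ∧ (∀ S : Finset (Fin d → I), Real.log S.card ≤ B) ∧
      ∀ S : Finset (Fin d → J), Real.log S.card ≤ B := by
    refine ⟨Fintype.card (Fin d → I) + Fintype.card (Fin d → J) + 1, by positivity, ?_, ?_⟩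
    · intro S
      have h1 : (S.card : ℝ) ≤ Fintype.card (Fin d → I) := by exact_mod_cast S.card_le_univ
      have h2 := Real.log_le_self (Nat.cast_nonneg (α := ℝ) S.card)
      have h3 : (0 : ℝ) ≤ Fintype.card (Fin d → J) := Nat.cast_nonneg _
      linarith
    · intro S
      have h1 : (S.card : ℝ) ≤ Fintype.card (Fin d → J) := by exact_mod_cast S.card_le_univ
      have h2 := Real.log_le_self (Nat.cast_nonneg (α := ℝ) S.card)
      have h3 : (0 : ℝ) ≤ Fintype.card (Fin d → I) := Nat.cast_nonneg _
      linarith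
  have hbound : ∀ ε : ℝ, 0 < ε → ε * B ≤ 1 →
      sigmaPAR M ≤ (Real.exp (ε * B ^ 2) * V) ^ (1 / (d : ℝ)) := by
    intro ε hε hεB
    have hsub : Tendsto (fun n : ℕ => d * n) atTop atTop :=
      tendsto_id.const_mul_atTop' hd
    have hlhs := hlim.comp hsub
    -- Along the multiples of `d`, the constant `2 * 2 ^ ε⁻¹` disappears under the `d * n`-th root.
    have hrhs : Tendsto (fun n : ℕ => ((2 * 2 ^ ε⁻¹ : ℝ) ^ (1 / ((d * n : ℕ) : ℝ))) *
        (Real.exp (ε * B ^ 2) * V) ^ (1 / (d : ℝ))) atTop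
        (𝓝 ((2 * 2 ^ ε⁻¹ : ℝ) ^ (0 : ℝ) * (Real.exp (ε * B ^ 2) * V) ^ (1 / (d : ℝ)))) := by
      refine Tendsto.mul_const _ ?_
      have h0 : Tendsto (fun n : ℕ => 1 / ((d * n : ℕ) : ℝ)) atTop (𝓝 0) :=
        tendsto_one_div_atTop_nhds_zero_nat.comp hsub
      exact tendsto_const_nhds.rpow h0 (Or.inl (by positivity))
    rw [Real.rpow_zero, one_mul] at hrhs
    refine le_of_tendsto_of_tendsto hlhs hrhs ?_
    filter_upwards [eventually_gt_atTop 0] with n hn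
    obtain ⟨P, hP, hne, hs⟩ := exists_isPartitioning_powNorm_le hε hV.le hIB hJB hεB hM n
    have hn0 : (0 : ℝ) < n := by exact_mod_cast hn
    have hsize : (sizePAR (kroneckerPower M (d * n)) : ℝ) ≤
        2 * 2 ^ ε⁻¹ * (Real.exp (ε * B ^ 2) * V) ^ n := by
      calc (sizePAR (kroneckerPower M (d * n)) : ℝ)
          ≤ ((P.map fun Q => Q.1.card + Q.2.card).sum : ℕ) := by exact_mod_cast sizePAR_le hP
        _ = (P.map fun Q => (Q.1.card + Q.2.card : ℝ)).sum := by
            rw [Nat.cast_multiset_sum, Multiset.map_map]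
            simp
        _ ≤ (P.map fun Q => 2 * powNorm ε Q.1.card Q.2.card).sum := by
            refine Multiset.sum_map_le_sum_map _ _ fun Q _ => ?_
            have h1 := le_powNorm_left hε (Nat.cast_nonneg (α := ℝ) Q.1.card)
              (Nat.cast_nonneg (α := ℝ) Q.2.card)
            have h2 := le_powNorm_right hε (Nat.cast_nonneg (α := ℝ) Q.1.card)
              (Nat.cast_nonneg (α := ℝ) Q.2.card)
            linarith
        _ ≤ _ := by
            rw [Multiset.sum_map_mul_left, mul_assoc]
            gcongr
    calc (sizePAR (kroneckerPower M (d * n)) : ℝ) ^ (1 / ((d * n : ℕ) : ℝ))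
        ≤ (2 * 2 ^ ε⁻¹ * (Real.exp (ε * B ^ 2) * V) ^ n) ^ (1 / ((d * n : ℕ) : ℝ)) := by gcongr
      _ = _ := by
          rw [Real.mul_rpow (by positivity) (by positivity)]
          congr 1
          rw [← Real.rpow_natCast, ← Real.rpow_mul (by positivity)]
          congr 1
          push_cast
          field_simp
  have hcont : Tendsto (fun ε : ℝ => (Real.exp (ε * B ^ 2) * V) ^ (1 / (d : ℝ))) (𝓝[>] 0)
      (𝓝 ((Real.exp (0 * B ^ 2) * V) ^ (1 / (d : ℝ)))) := by
    have hc : Continuous fun ε : ℝ => (Real.exp (ε * B ^ 2) * V) ^ (1 / (d : ℝ)) := by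
      refine Continuous.rpow_const (by fun_prop) fun ε => Or.inr (by positivity)
    exact (hc.tendsto 0).mono_left nhdsWithin_le_nhds
  rw [zero_mul, Real.exp_zero, one_mul] at hcont
  refine ge_of_tendsto hcont ?_
  filter_upwards [self_mem_nhdsWithin, Ioo_mem_nhdsGT (inv_pos.2 hB0)] with ε hε hε'
  refine hbound ε hε ?_
  have := hε'.2.le
  calc ε * B ≤ B⁻¹ * B := by gcongr
    _ = 1 := inv_mul_cancel₀ hB0.ne'

end

/-! ### Outputs of the merging procedure are partitionings -/

/-- The number of rectangles of a family that contain an entry. -/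
def coverCount {I J : Type*} [DecidableEq I] [DecidableEq J] (P : Multiset (Rectangle I J))
    (i : I) (j : J) : ℕ :=
  (P.map fun Q => if i ∈ Q.1 ∧ j ∈ Q.2 then 1 else 0).sum

section

variable {I J : Type*} [DecidableEq I] [DecidableEq J]

theorem coverCount_add (P P' : Multiset (Rectangle I J)) (i : I) (j : J) :
    coverCount (P + P') i j = coverCount P i j + coverCount P' i j := by
  simp [coverCount]

theorem coverCount_swapRects (P : Multiset (Rectangle I J)) (i : I) (j : J) :
    coverCount (swapRects P) j i = coverCount P i j := by
  simp only [coverCount, swapRects, Multiset.map_map, Function.comp_def, Prod.fst_swap,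
    Prod.snd_swap]
  congr 1
  refine Multiset.map_congr rfl fun Q _ => ?_
  congr 1
  exact propext and_comm

theorem coverCount_map {ι : Type*} (s : Finset ι) (f : ι → Rectangle I J) (i : I) (j : J) :
    coverCount (s.val.map f) i j = ∑ x ∈ s, if i ∈ (f x).1 ∧ j ∈ (f x).2 then 1 else 0 := by
  rw [coverCount, Multiset.map_map]
  rfl

theorem coverCount_bind {ι : Type*} (s : Finset ι) (f : ι → Multiset (Rectangle I J))
    (i : I) (j : J) : coverCount (s.val.bind f) i j = ∑ x ∈ s, coverCount (f x) i j := by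
  rw [coverCount, Multiset.map_bind, Multiset.sum_bind]
  rfl

end

/-- Rectangles with one row each cover an entry at most once. -/
theorem coverCount_map_singleton {I J : Type*} [DecidableEq I] [DecidableEq J] (s : Finset I)
    (f : I → Finset J) (i : I) (j : J) :
    coverCount (s.val.map fun x => ({x}, f x)) i j = if i ∈ s ∧ j ∈ f i then 1 else 0 := by
  rw [coverCount_map]
  simp only [Finset.mem_singleton, ite_and]
  rw [Finset.sum_ite_eq]

theorem coverCount_rowRects (d r c : ℕ) (S T : Finset (Fin d)) :
    coverCount (rowRects d r c) S T = if Disjoint S T ∧ S.card = r ∧ c ≤ T.card then 1 else 0 := by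
  rw [rowRects, coverCount_map_singleton]
  simp only [Finset.mem_filter, Finset.mem_univ, true_and, disjoint_comm (a := T)]
  congr 1
  exact propext (by tauto)

/-- A common `r`-subset would lie in the intersection, which has fewer than `r` points. This makes
both the covering and the counting of merged sets unambiguous. -/
theorem IsPacking.eq_of_subset {d r a : ℕ} {𝒮 : Finset (Finset (Fin d))} (h : IsPacking r a 𝒮)
    {S S₁ S₂ : Finset (Fin d)} (hS : S.card = r) (h₁ : S₁ ∈ 𝒮) (h₂ : S₂ ∈ 𝒮) (hS₁ : S ⊆ S₁)
    (hS₂ : S ⊆ S₂) : S₁ = S₂ := by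
  by_contra hne
  have := h.2.2 S₁ h₁ S₂ h₂ hne
  have := Finset.card_le_card (Finset.subset_inter hS₁ hS₂)
  omega

/-- A row contained in a chosen set `S'`, unique by the packing condition, has its columns disjoint
from `S'` in the merged rectangle; those meeting `S'` occur only if it has size `r` and lie in the
third family. Every other row is covered by its own rectangle in the second family. -/
theorem coverCount_rowMergeRects {d r a : ℕ} (c : ℕ) {𝒮 : Finset (Finset (Fin d))}
    (h : IsPacking r a 𝒮) (S T : Finset (Fin d)) :
    coverCount (rowMergeRects d r c 𝒮) S T =
      if Disjoint S T ∧ (S.card = r ∨ S.card = r + 1) ∧ c ≤ T.card then 1 else 0 := by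
  have hsub : ∀ S' ∈ 𝒮, S ⊆ S' → S.card = r + 1 → S' = S := fun S' hS' hS hc =>
    (Finset.eq_of_subset_of_card_le hS (by rw [h.2.1 S' hS', hc])).symm
  rw [rowMergeRects, coverCount_add, coverCount_add, coverCount_map_singleton, coverCount_map,
    coverCount_bind]
  simp only [coverCount_map_singleton]
  simp only [Finset.mem_filter, Finset.mem_univ, true_and]
  by_cases hST : Disjoint S T ∧ (S.card = r ∨ S.card = r + 1) ∧ c ≤ T.card
  · obtain ⟨hd, hc, hT⟩ := hST
    have hd' := hd.symm
    rw [if_pos (⟨hd, hc, hT⟩ : Disjoint S T ∧ _)]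
    by_cases hex : ∃ S' ∈ 𝒮, S ⊆ S'
    · obtain ⟨S', hS', hSS'⟩ := hex
      have huniq : ∀ S₁ ∈ 𝒮, S ⊆ S₁ → S₁ = S' := by
        intro S₁ h₁ hS₁
        rcases hc with hc | hc
        · exact h.eq_of_subset hc h₁ hS' hS₁ hSS'
        · rw [hsub S₁ h₁ hS₁ hc, hsub S' hS' hSS' hc]
      rw [Finset.sum_eq_single_of_mem S' hS' fun S₁ h₁ hne =>
        if_neg fun hh => hne (huniq S₁ h₁ hh.1.1)]
      rw [Finset.sum_eq_single_of_mem S' hS' fun S₁ h₁ hne =>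
        if_neg fun hh => hne (huniq S₁ h₁ hh.1.1)]
      rw [if_neg (c := (S.card = r + 1 ∧ S ∉ 𝒮 ∨ _) ∧ _)]
      · rcases hc with hc | hc
        · by_cases hTS : Disjoint T S' <;> simp [hSS', hc, hTS, hT, hd']
        · rw [hsub S' hS' hSS' hc]
          simp [hc, hT, hd']
      · rintro ⟨⟨hc', hn⟩ | ⟨-, hn⟩, -⟩
        · rw [hsub S' hS' hSS' hc'] at hS'
          exact hn hS'
        · exact hn S' hS' hSS'
    · push Not at hex
      rw [Finset.sum_eq_zero fun S₁ h₁ => if_neg fun hh => hex S₁ h₁ hh.1.1,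
        Finset.sum_eq_zero fun S₁ h₁ => if_neg fun hh => hex S₁ h₁ hh.1.1, if_pos]
      · rfl
      refine ⟨?_, hd', hT⟩
      rcases hc with hc | hc
      · exact .inr ⟨hc, hex⟩
      · exact .inl ⟨hc, fun hS => hex S hS subset_rfl⟩
  · have hcard : ∀ S' ∈ 𝒮, S ⊆ S' → r ≤ S.card → S.card = r ∨ S.card = r + 1 := by
      intro S' hS' hSS' hr
      have := Finset.card_le_card hSS'
      have := h.2.1 S' hS'
      omega
    rw [if_neg hST, Finset.sum_eq_zero, Finset.sum_eq_zero, if_neg]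
    · rfl
    · rintro ⟨h1, h2, h3⟩
      exact hST ⟨h2.symm, by tauto, h3⟩
    · intro S' hS'
      refine if_neg ?_
      rintro ⟨⟨h1, h2⟩, h3, h4, h5⟩
      exact hST ⟨h3.symm, .inl h2, h5⟩
    · intro S' hS'
      refine if_neg ?_
      rintro ⟨⟨h1, h2⟩, h3, h4⟩
      exact hST ⟨(h3.mono_right h1).symm, hcard S' hS' h1 h2, h4⟩

/-- The amount by which a word increases the row counter. -/
def rowsRead : List Letter → ℕ
  | [] => 0
  | .row :: w => rowsRead w + 1
  | .rowMerge _ :: w => rowsRead w + 2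
  | .col :: w | .colMerge _ :: w => rowsRead w

/-- The amount by which a word increases the column counter. -/
def colsRead : List Letter → ℕ
  | [] => 0
  | .col :: w => colsRead w + 1
  | .colMerge _ :: w => colsRead w + 2
  | .row :: w | .rowMerge _ :: w => colsRead w

/-- The procedure covers the disjoint pairs up to those that the final counters leave over. -/
theorem MergeRun.coverCount_eq {d r c : ℕ} {w : List Letter}
    {P : Multiset (Rectangle (Finset (Fin d)) (Finset (Fin d)))} (h : MergeRun d w r c P)
    (S T : Finset (Fin d)) :
    coverCount P S T = if Disjoint S T ∧ (r ≤ S.card ∧ c ≤ T.card) ∧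
      ¬ (r + rowsRead w ≤ S.card ∧ c + colsRead w ≤ T.card) then 1 else 0 := by
  induction h with
  | nil r c => simp [coverCount, rowsRead, colsRead]
  | row h ih =>
    rw [coverCount_add, coverCount_rowRects, ih, rowsRead, colsRead]
    by_cases hd : Disjoint S T
    · simp only [hd, true_and]
      split_ifs <;> omega
    · simp [hd]
  | col h ih =>
    rw [coverCount_add, coverCount_swapRects, coverCount_rowRects, ih, rowsRead, colsRead]
    by_cases hd : Disjoint S T
    · simp only [hd, hd.symm, true_and]
      split_ifs <;> omega
    · simp [hd, disjoint_comm.not.1 hd]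
  | rowMerge 𝒮 h𝒮 h ih =>
    rw [coverCount_add, coverCount_rowMergeRects _ h𝒮, ih, rowsRead, colsRead]
    by_cases hd : Disjoint S T
    · simp only [hd, true_and]
      split_ifs <;> omega
    · simp [hd]
  | colMerge 𝒮 h𝒮 h ih =>
    rw [coverCount_add, coverCount_swapRects, coverCount_rowMergeRects _ h𝒮, ih, rowsRead, colsRead]
    by_cases hd : Disjoint S T
    · simp only [hd, hd.symm, true_and]
      split_ifs <;> omega
    · simp [hd, disjoint_comm.not.1 hd]

theorem kroneckerPower_disjointnessMatrix_indicatorTuple {d : ℕ} (S T : Finset (Fin d)) :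
    kroneckerPower (disjointnessMatrix ℕ) d (indicatorTuple S) (indicatorTuple T) =
      if Disjoint S T then 1 else 0 := by
  have h : ∀ t, disjointnessMatrix ℕ (indicatorTuple S t) (indicatorTuple T t) =
      if t ∈ S → t ∉ T then 1 else 0 := by
    intro t
    by_cases h1 : t ∈ S <;> by_cases h2 : t ∈ T <;>
      simp [disjointnessMatrix, indicatorTuple, h1, h2]
  simp only [kroneckerPower, Matrix.of_apply, h, Finset.disjoint_left]
  split_ifs with h'
  · exact Finset.prod_eq_one fun t _ => if_pos (h' (a := t))
  · push Not at h'
    obtain ⟨t, h1, h2⟩ := h'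
    exact Finset.prod_eq_zero (Finset.mem_univ t) (if_neg fun h => h h1 h2)

/-- Once the final counters add up to more than `d`, the output is a partitioning. -/
theorem MergeRun.isPartitioning {d : ℕ} {w : List Letter}
    {P : Multiset (Rectangle (Finset (Fin d)) (Finset (Fin d)))} (h : MergeRun d w 0 0 P)
    (hw : d < rowsRead w + colsRead w) :
    IsPartitioning P
      ((kroneckerPower (disjointnessMatrix ℕ) d).submatrix indicatorTuple indicatorTuple) := by
  intro S T
  rw [Matrix.submatrix_apply, kroneckerPower_disjointnessMatrix_indicatorTuple]
  change coverCount P S T = _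
  rw [h.coverCount_eq]
  by_cases hd : Disjoint S T
  -- Disjoint sets have at most `d` points together, so they cannot reach both final counters.
  · have h1 := Finset.card_le_univ (S ∪ T)
    rw [Finset.card_union_of_disjoint hd, Fintype.card_fin] at h1
    rw [if_pos hd, if_pos ⟨hd, ⟨Nat.zero_le _, Nat.zero_le _⟩, by omega⟩]
  · simp [hd]

/-! ### The volume of an output -/

section

variable {I J : Type*}

theorem alphaVolume_add (P P' : Multiset (Rectangle I J)) (α : ℝ) :
    alphaVolume (P + P') α = alphaVolume P α + alphaVolume P' α := by
  simp [alphaVolume]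

theorem alphaVolume_swapRects (P : Multiset (Rectangle I J)) (α : ℝ) :
    alphaVolume (swapRects P) α = alphaVolume P (1 - α) := by
  simp [alphaVolume, swapRects, mul_comm]

theorem alphaVolume_map {ι : Type*} (s : Finset ι) (f : ι → Rectangle I J) (α : ℝ) :
    alphaVolume (s.val.map f) α =
      ∑ x ∈ s, ((f x).1.card : ℝ) ^ α * ((f x).2.card : ℝ) ^ (1 - α) := by
  rw [alphaVolume, Multiset.map_map]
  rfl

theorem alphaVolume_bind {ι : Type*} (s : Finset ι) (f : ι → Multiset (Rectangle I J)) (α : ℝ) :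
    alphaVolume (s.val.bind f) α = ∑ x ∈ s, alphaVolume (f x) α := by
  rw [alphaVolume, Multiset.map_bind, Multiset.sum_bind]
  rfl

end

/-- The number of subsets of size at least `c` of a set of size `n`. -/
def upperCount (n c : ℕ) : ℕ := ∑ j ∈ Finset.Icc c n, n.choose j

theorem card_filter_disjoint {d : ℕ} (S : Finset (Fin d)) (c : ℕ) :
    (Finset.univ.filter fun T => Disjoint T S ∧ c ≤ T.card).card = upperCount (d - S.card) c := by
  have hmaps : Set.MapsTo Finset.card
      (↑(Finset.univ.filter fun T : Finset (Fin d) => Disjoint T S ∧ c ≤ T.card) :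
        Set (Finset (Fin d)))
      (↑(Finset.Icc c (d - S.card)) : Set ℕ) := by
    intro T hT
    simp only [Finset.coe_filter, Finset.mem_univ, true_and, Set.mem_ofPred_eq] at hT
    have h := Finset.card_le_univ (T ∪ S)
    rw [Finset.card_union_of_disjoint hT.1, Fintype.card_fin] at h
    simp only [Finset.coe_Icc, Set.mem_Icc]
    omega
  rw [Finset.card_eq_sum_card_fiberwise hmaps, upperCount]
  refine Finset.sum_congr rfl fun j hj => ?_
  rw [Finset.mem_Icc] at hj
  have : (Finset.univ.filter fun T : Finset (Fin d) => Disjoint T S ∧ c ≤ T.card).filter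
      (fun T => T.card = j) = Finset.powersetCard j Sᶜ := by
    ext T
    simp only [Finset.mem_filter, Finset.mem_univ, true_and, Finset.mem_powersetCard,
      Finset.subset_compl_iff_disjoint_right]
    constructor
    · rintro ⟨⟨h1, -⟩, h2⟩
      exact ⟨h1, h2⟩
    · rintro ⟨h1, h2⟩
      exact ⟨⟨h1, h2 ▸ hj.1⟩, h2⟩
  rw [this, Finset.card_powersetCard, Finset.card_compl, Fintype.card_fin]

theorem upperCount_succ_self (r : ℕ) : upperCount (r + 1) r = r + 2 := by
  have : Finset.Icc r (r + 1) = {r, r + 1} := by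
    ext j
    simp only [Finset.mem_Icc, Finset.mem_insert, Finset.mem_singleton]
    omega
  rw [upperCount, this, Finset.sum_pair (by omega), Nat.choose_self, Nat.choose_succ_self_right]

/-- The volume of a rectangle with `i` rows and `j` columns. -/
noncomputable def rectVolume (α : ℝ) (i j : ℕ) : ℝ := (i : ℝ) ^ α * (j : ℝ) ^ (1 - α)

theorem rectVolume_one_sub (α : ℝ) (i j : ℕ) : rectVolume (1 - α) i j = rectVolume α j i := by
  rw [rectVolume, rectVolume, sub_sub_cancel, mul_comm]

/-- The volume of `rowRects d r c`. -/
noncomputable def rowVolume (d r c : ℕ) (α : ℝ) : ℝ :=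
  d.choose r * rectVolume α 1 (upperCount (d - r) c)

/-- The volume of `rowMergeRects d r c 𝒮` for any choice `𝒮` of `a` sets. -/
noncomputable def rowMergeVolume (d r c a : ℕ) (α : ℝ) : ℝ :=
  a * rectVolume α (r + 2) (upperCount (d - (r + 1)) c) +
  ((d.choose (r + 1) - a : ℕ) * rectVolume α 1 (upperCount (d - (r + 1)) c) +
    (d.choose r - a * (r + 1) : ℕ) * rectVolume α 1 (upperCount (d - r) c)) +
  a * ((r + 1 : ℕ) * rectVolume α 1 (upperCount (d - r) c - upperCount (d - (r + 1)) c))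

/-- The volume of the output of the procedure on a word. -/
noncomputable def wordVolume (d : ℕ) : List Letter → ℕ → ℕ → ℝ → ℝ
  | [], _, _, _ => 0
  | .row :: w, r, c, α => rowVolume d r c α + wordVolume d w (r + 1) c α
  | .col :: w, r, c, α => rowVolume d c r (1 - α) + wordVolume d w r (c + 1) α
  | .rowMerge a :: w, r, c, α => rowMergeVolume d r c a α + wordVolume d w (r + 2) c α
  | .colMerge a :: w, r, c, α => rowMergeVolume d c r a (1 - α) + wordVolume d w r (c + 2) α

theorem alphaVolume_rowRects (d r c : ℕ) (α : ℝ) :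
    alphaVolume (rowRects d r c) α = rowVolume d r c α := by
  rw [rowRects, alphaVolume_map, rowVolume]
  rw [Finset.sum_congr rfl (g := fun _ => rectVolume α 1 (upperCount (d - r) c))]
  · rw [Finset.sum_const, nsmul_eq_mul]
    congr 2
    have : (Finset.univ.filter fun S : Finset (Fin d) => S.card = r) =
        Finset.powersetCard r Finset.univ := by
      ext S; simp
    rw [this, Finset.card_powersetCard, Finset.card_univ, Fintype.card_fin]
  · intro S hS
    rw [Finset.mem_filter] at hS
    rw [card_filter_disjoint, hS.2, Finset.card_singleton, rectVolume]

/-- The chosen sets have pairwise distinct `r`-subsets, so exactly `a * (r + 1)` sets of size `r`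
are merged whatever the choice. All side lengths depend only on cardinalities. -/
theorem alphaVolume_rowMergeRects {d r a : ℕ} (c : ℕ) {𝒮 : Finset (Finset (Fin d))}
    (h : IsPacking r a 𝒮) (α : ℝ) :
    alphaVolume (rowMergeRects d r c 𝒮) α = rowMergeVolume d r c a α := by
  have hpc : ∀ k : ℕ, (Finset.univ.filter fun S : Finset (Fin d) => S.card = k) =
      Finset.powersetCard k Finset.univ := by
    intro k; ext S; simp
  have hsubcard : ∀ S' ∈ 𝒮, (Finset.univ.filter fun S => S ⊆ S' ∧ S.card = r).card = r + 1 := by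
    intro S' hS'
    have : (Finset.univ.filter fun S => S ⊆ S' ∧ S.card = r) = Finset.powersetCard r S' := by
      ext S; simp [Finset.mem_powersetCard]
    rw [this, Finset.card_powersetCard, h.2.1 S' hS', Nat.choose_succ_self_right]
  rw [rowMergeRects, alphaVolume_add, alphaVolume_add, alphaVolume_map, alphaVolume_map,
    alphaVolume_bind, rowMergeVolume]
  congr 1
  · congr 1
    · rw [← h.1, ← nsmul_eq_mul, ← Finset.sum_const]
      refine Finset.sum_congr rfl fun S' hS' => ?_
      have h1 := h.2.1 S' hS'
      have h2 : (Finset.univ.filter fun S => S ⊆ S' ∧ r ≤ S.card).card = r + 2 := by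
        -- Subsets of `S'` are the sets disjoint from its complement, so the column count applies to
        -- rows: `S'` and its `r + 1` subsets of size `r`.
        have := card_filter_disjoint S'ᶜ r
        simp only [disjoint_compl_right_iff] at this
        have hle := Finset.card_le_univ S'
        rw [Fintype.card_fin] at hle
        rw [this, Finset.card_compl, Fintype.card_fin, Nat.sub_sub_self hle, h1,
          upperCount_succ_self]
      rw [h2, card_filter_disjoint, h1, rectVolume]
    · have hdisj : Disjoint (Finset.univ.filter fun S : Finset (Fin d) => S.card = r + 1 ∧ S ∉ 𝒮)
          (Finset.univ.filter fun S : Finset (Fin d) => S.card = r ∧ ∀ S' ∈ 𝒮, ¬ S ⊆ S') := by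
        rw [Finset.disjoint_filter]
        intro S _ h1 h2
        omega
      rw [Finset.filter_or, Finset.sum_union hdisj]
      congr 1
      · have hcard : (Finset.univ.filter fun S : Finset (Fin d) => S.card = r + 1 ∧ S ∉ 𝒮).card =
            d.choose (r + 1) - a := by
          have h1 : (Finset.univ.filter fun S : Finset (Fin d) => S.card = r + 1 ∧ S ∉ 𝒮) =
              Finset.powersetCard (r + 1) Finset.univ \ 𝒮 := by
            rw [← hpc]; ext S; simp
          rw [h1, Finset.card_sdiff_of_subset, Finset.card_powersetCard, Finset.card_univ,
            Fintype.card_fin, h.1]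
          intro S hS
          simpa using h.2.1 S hS
        rw [← hcard, ← nsmul_eq_mul, ← Finset.sum_const]
        refine Finset.sum_congr rfl fun S hS => ?_
        rw [card_filter_disjoint, (Finset.mem_filter.1 hS).2.1, Finset.card_singleton, rectVolume]
      · have hcard : (Finset.univ.filter fun S : Finset (Fin d) =>
            S.card = r ∧ ∀ S' ∈ 𝒮, ¬ S ⊆ S').card = d.choose r - a * (r + 1) := by
          have h1 : (Finset.univ.filter fun S : Finset (Fin d) =>
              S.card = r ∧ ∀ S' ∈ 𝒮, ¬ S ⊆ S') =
              Finset.powersetCard r Finset.univ \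
                𝒮.biUnion fun S' => Finset.univ.filter fun S => S ⊆ S' ∧ S.card = r := by
            rw [← hpc]
            ext S
            simp only [Finset.mem_filter, Finset.mem_univ, true_and, Finset.mem_sdiff,
              Finset.mem_biUnion, not_exists, not_and]
            constructor
            · rintro ⟨h1, h2⟩
              exact ⟨h1, fun S' hS' hh => absurd hh (h2 S' hS')⟩
            · rintro ⟨h1, h2⟩
              exact ⟨h1, fun S' hS' hh => h2 S' hS' hh h1⟩
          rw [h1, Finset.card_sdiff_of_subset, Finset.card_powersetCard, Finset.card_univ,
            Fintype.card_fin, Finset.card_biUnion, Finset.sum_congr rfl hsubcard, Finset.sum_const,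
            h.1, smul_eq_mul]
          · intro S₁ h₁ S₂ h₂ hne
            refine Finset.disjoint_filter.2 ?_
            exact fun S _ hS₁ hS₂ => hne (h.eq_of_subset hS₁.2 h₁ h₂ hS₁.1 hS₂.1)
          · intro S hS
            obtain ⟨S', hS', hS⟩ := Finset.mem_biUnion.1 hS
            simpa using (Finset.mem_filter.1 hS).2.2
        rw [← hcard, ← nsmul_eq_mul, ← Finset.sum_const]
        refine Finset.sum_congr rfl fun S hS => ?_
        rw [card_filter_disjoint, (Finset.mem_filter.1 hS).2.1, Finset.card_singleton, rectVolume]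
  · rw [← h.1, ← nsmul_eq_mul, ← Finset.sum_const]
    refine Finset.sum_congr rfl fun S' hS' => ?_
    rw [alphaVolume_map, ← hsubcard S' hS', ← nsmul_eq_mul, ← Finset.sum_const]
    refine Finset.sum_congr rfl fun S hS => ?_
    have hS2 := (Finset.mem_filter.1 hS).2
    have hcard : (Finset.univ.filter fun T => Disjoint T S ∧ ¬ Disjoint T S' ∧ c ≤ T.card).card =
        upperCount (d - r) c - upperCount (d - (r + 1)) c := by
      have h1 : (Finset.univ.filter fun T => Disjoint T S ∧ ¬ Disjoint T S' ∧ c ≤ T.card) =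
          (Finset.univ.filter fun T => Disjoint T S ∧ c ≤ T.card) \
            (Finset.univ.filter fun T => Disjoint T S' ∧ c ≤ T.card) := by
        ext T
        simp only [Finset.mem_filter, Finset.mem_univ, true_and, Finset.mem_sdiff]
        tauto
      rw [h1, Finset.card_sdiff_of_subset, card_filter_disjoint, card_filter_disjoint, hS2.2,
        h.2.1 S' hS']
      intro T hT
      simp only [Finset.mem_filter, Finset.mem_univ, true_and] at hT ⊢
      exact ⟨hT.1.mono_right hS2.1, hT.2⟩
    rw [hcard, hsubcard S' hS', Finset.card_singleton, rectVolume]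

/-- The volume of an output does not depend on the choices. -/
theorem MergeRun.alphaVolume_eq {d r c : ℕ} {w : List Letter}
    {P : Multiset (Rectangle (Finset (Fin d)) (Finset (Fin d)))} (h : MergeRun d w r c P) (α : ℝ) :
    alphaVolume P α = wordVolume d w r c α := by
  induction h with
  | nil => simp [alphaVolume, wordVolume]
  | row h ih => rw [alphaVolume_add, alphaVolume_rowRects, ih, wordVolume]
  | col h ih => rw [alphaVolume_add, alphaVolume_swapRects, alphaVolume_rowRects, ih, wordVolume]
  | rowMerge 𝒮 h𝒮 h ih => rw [alphaVolume_add, alphaVolume_rowMergeRects _ h𝒮, ih, wordVolume]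
  | colMerge 𝒮 h𝒮 h ih =>
    rw [alphaVolume_add, alphaVolume_swapRects, alphaVolume_rowMergeRects _ h𝒮, ih, wordVolume]

/-! ### Packings given by bit masks -/

/-- The set of the positions below `18` of the binary digits `1` of `m`. -/
def ofMask (m : ℕ) : Finset (Fin 18) := Finset.univ.filter fun i => m.testBit i

/-- The number of binary digits `1` of `m` at the positions below `18`. -/
def bitCount (m : ℕ) : ℕ :=
  m % 2 + m / 2 % 2 + m / 4 % 2 + m / 8 % 2 + m / 16 % 2 + m / 32 % 2 + m / 64 % 2 +
  m / 128 % 2 + m / 256 % 2 + m / 512 % 2 + m / 1024 % 2 + m / 2048 % 2 + m / 4096 % 2 +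
  m / 8192 % 2 + m / 16384 % 2 + m / 32768 % 2 + m / 65536 % 2 + m / 131072 % 2

theorem card_ofMask (m : ℕ) : (ofMask m).card = bitCount m := by
  have h : ∀ n : ℕ, (if n % 2 = 1 then 1 else 0) = n % 2 := by
    intro n
    rcases Nat.mod_two_eq_zero_or_one n with h | h <;> simp [h]
  simp only [ofMask, Finset.card_filter, Nat.testBit_eq_decide_div_mod_eq, decide_eq_true_eq, h]
  simp only [Fin.sum_univ_succ, Fin.sum_univ_zero, bitCount]
  simp [add_assoc]

theorem ofMask_inter (m n : ℕ) : ofMask m ∩ ofMask n = ofMask (m &&& n) := by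
  ext i
  simp [ofMask]

/-- Whether any two of the masks in a list have fewer than `r` digits `1` in common. -/
def masksApart (r : ℕ) : List ℕ → Bool
  | [] => true
  | m :: l => l.all (fun n => Nat.blt (bitCount (m &&& n)) r) && masksApart r l

theorem pairwise_of_masksApart {r : ℕ} : ∀ {l : List ℕ}, masksApart r l = true →
    l.Pairwise fun m n => (ofMask m ∩ ofMask n).card < r
  | [], _ => List.Pairwise.nil
  | m :: l, h => by
    rw [masksApart, Bool.and_eq_true, List.all_eq_true] at h
    refine List.Pairwise.cons (fun n hn => ?_) (pairwise_of_masksApart h.2)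
    rw [ofMask_inter, card_ofMask]
    exact Nat.blt_eq.mp (h.1 n hn)

theorem isPacking_of_masks {r : ℕ} {l : List ℕ} (h₁ : (l.all fun m => bitCount m == r + 1) = true)
    (h₂ : masksApart r l = true) : IsPacking r l.length (l.map ofMask).toFinset := by
  have hcard : ∀ m ∈ l, (ofMask m).card = r + 1 := by
    intro m hm
    rw [card_ofMask]
    exact beq_iff_eq.1 (List.all_eq_true.1 h₁ m hm)
  have hpw := pairwise_of_masksApart h₂
  refine ⟨?_, ?_, ?_⟩
  · rw [List.toFinset_card_of_nodup, List.length_map]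
    rw [List.Nodup, List.pairwise_map]
    refine hpw.imp_of_mem fun {m n} hm hn h heq => ?_
    rw [heq, Finset.inter_self, hcard n hn] at h
    omega
  · intro S hS
    obtain ⟨m, hm, rfl⟩ := List.mem_map.1 (List.mem_toFinset.1 hS)
    exact hcard m hm
  · intro S hS S' hS' hne
    obtain ⟨m, hm, rfl⟩ := List.mem_map.1 (List.mem_toFinset.1 hS)
    obtain ⟨n, hn, rfl⟩ := List.mem_map.1 (List.mem_toFinset.1 hS')
    have hsymm : Std.Symm fun m n => (ofMask m ∩ ofMask n).card < r :=
      ⟨fun m n h => by rwa [Finset.inter_comm]⟩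
    exact hpw.forall hm hn fun h => hne (h ▸ rfl)

/-- The nine pairs `{2 i, 2 i + 1}`. -/
def pairMasks : List ℕ :=
  [3, 12, 48, 192, 768, 3072, 12288, 49152, 196608]

/-- With `6 i + x`, where `x` is taken modulo `6`, written as `(i, x)` for `i` modulo `3`: the
quadruples `(i, x), (i, x + 1), (i + 1, p), (i + 2, q)` where `x + p + q = 2 i` modulo `6`, the
quadruples `(i, x), (i, y), (i + 1, p), (i + 1, q)` where `y - x` and `q - p` are not `0` or `±1`
modulo `6` and `x + y = p + q` modulo `3`, and three quadruples in each of the sets of the `(i, x)`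
for fixed `i`. -/
def quadrupleMasks : List ℕ :=
  [4163, 131203, 65795, 33283, 17411, 10243, 131142, 65670, 33030, 16902, 9222, 6150, 65612,
   32908, 16652, 8716, 5132, 133132, 32856, 16536, 8472, 4632, 132120, 67608, 16496, 8368, 4400,
   131632, 66608, 34864, 8289, 4257, 131361, 66081, 33825, 18465, 4292, 8386, 16577, 32992, 65744,
   131272, 4482, 8577, 16800, 33168, 65928, 131460, 4865, 8992, 17168, 33544, 66308, 131842, 5664,
   9744, 17928, 34308, 67074, 132609, 7184, 11272, 19460, 35842, 68609, 134176, 6216, 10308,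
   18498, 34881, 67680, 133200, 13313, 12802, 12548, 12424, 12368, 14368, 25089, 24834, 24708,
   24648, 26640, 25632, 49409, 49282, 49220, 51208, 50192, 49696, 98433, 98370, 100356, 99336,
   98832, 98592, 196673, 198658, 197636, 197128, 196880, 196768, 137217, 136194, 135684, 135432,
   135312, 135264, 325, 1157, 2565, 585, 2185, 1289, 1105, 657, 2321, 1098, 650, 2314, 338, 1170,
   2578, 610, 2210, 1314, 596, 2196, 1300, 1124, 676, 2340, 360, 1192, 2600, 20800, 74048, 164160,
   37440, 139840, 82496, 70720, 42048, 148544, 70272, 41600, 148096, 21632, 74880, 164992, 39040,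
   141440, 84096, 38144, 140544, 83200, 71936, 43264, 149760, 23040, 76288, 166400, 20485, 20498,
   20520, 36873, 36898, 36884, 69649, 69642, 69668, 40977, 40970, 40996, 73733, 73746, 73768,
   139273, 139298, 139284, 81929, 81954, 81940, 147473, 147466, 147492, 163845, 163858, 163880,
   15, 51, 60, 960, 3264, 3840, 61440, 208896, 245760]

theorem isPacking_pairs : IsPacking 1 9 (pairMasks.map ofMask).toFinset :=
  isPacking_of_masks (by decide +kernel) (by decide +kernel)

theorem isPacking_quadruples : IsPacking 3 198 (quadrupleMasks.map ofMask).toFinset :=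
  isPacking_of_masks (by decide +kernel) (by decide +kernel)

/-! ### Packings from colourings of the subsets of two halves -/

/-- A colouring of the `k`-subsets in which any two sets that arise from the same set by adding
one point each have different colours. -/
def IsProperColouring {V ι : Type*} [DecidableEq V] (k : ℕ) (f : Finset V → ι) : Prop :=
  ∀ (C : Finset V) (a b : V), C.card + 1 = k → a ∉ C → b ∉ C → f (insert a C) = f (insert b C) →
    a = b

/-- If the intersection had `k - 1` points, both sets would arise from it by adding one point, and
equal colours would force equal points. -/
theorem IsProperColouring.card_inter {V ι : Type*} [DecidableEq V] {k : ℕ} {f : Finset V → ι}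
    (hf : IsProperColouring k f) {A B : Finset V} (hA : A.card = k) (hB : B.card = k)
    (hfAB : f A = f B) (hne : A ≠ B) : (A ∩ B).card + 2 ≤ k := by
  by_contra hlt
  have h1 := Finset.card_sdiff_add_card_inter A B
  have h2 := Finset.card_sdiff_add_card_inter B A
  rw [Finset.inter_comm B A] at h2
  have h3 : (A \ B).card ≠ 0 := by
    intro h0
    rw [Finset.card_eq_zero, Finset.sdiff_eq_empty_iff_subset] at h0
    exact hne (Finset.eq_of_subset_of_card_le h0 (by omega))
  obtain ⟨a, ha⟩ := Finset.card_eq_one.1 (show (A \ B).card = 1 by omega)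
  obtain ⟨b, hb⟩ := Finset.card_eq_one.1 (show (B \ A).card = 1 by omega)
  have hA' : insert a (A ∩ B) = A := by
    rw [Finset.insert_eq, ← ha, Finset.sdiff_union_inter]
  have hB' : insert b (A ∩ B) = B := by
    rw [Finset.insert_eq, ← hb, Finset.inter_comm A B, Finset.sdiff_union_inter]
  have haB : a ∉ B := (Finset.mem_sdiff.1 (ha ▸ Finset.mem_singleton_self a)).2
  have hbA : b ∉ A := (Finset.mem_sdiff.1 (hb ▸ Finset.mem_singleton_self b)).2
  have hab := hf (A ∩ B) a b (by omega) (fun h => haB (Finset.mem_inter.1 h).2)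
    (fun h => hbA (Finset.mem_inter.1 h).1) (by rw [hA', hB', hfAB])
  exact hne (hA'.symm.trans (hab ▸ hB'))

/-- The sum modulo `n` of the elements of a set of residues. -/
def residueSum (n : ℕ) [NeZero n] (A : Finset (Fin n)) : Fin n := ∑ x ∈ A, x

/-- The sum of the common part cancels modulo `n`. -/
theorem isProperColouring_residueSum (n k : ℕ) [NeZero n] :
    IsProperColouring k (residueSum n) := by
  intro C a b _ ha hb h
  simpa [residueSum, Finset.sum_insert ha, Finset.sum_insert hb] using h

/-- The unions of a `k`-set in the first half and an `l`-set of the same colour in the second. -/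
@[irreducible]
def pairUp {V W ι : Type*} [Fintype V] [Fintype W] [DecidableEq V] [DecidableEq W] [DecidableEq ι]
    (k l : ℕ) (f : Finset V → ι) (g : Finset W → ι) : Finset (Finset (V ⊕ W)) :=
  ((Finset.powersetCard k Finset.univ ×ˢ Finset.powersetCard l Finset.univ).filter
    fun p : Finset V × Finset W => f p.1 = g p.2).image fun p => p.1.disjSum p.2

theorem card_inter_eq_toLeft_add_toRight {V W : Type*} [DecidableEq V]
    [DecidableEq W] (S S' : Finset (V ⊕ W)) :
    (S ∩ S').card = (S.toLeft ∩ S'.toLeft).card + (S.toRight ∩ S'.toRight).card := by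
  rw [← Finset.toLeft_inter, ← Finset.toRight_inter, Finset.card_toLeft_add_card_toRight]

theorem card_inter_lt_of_ne {V : Type*} [DecidableEq V] {A B : Finset V} {k : ℕ} (hA : A.card = k)
    (hB : B.card = k) (hne : A ≠ B) : (A ∩ B).card < k := by
  refine lt_of_le_of_ne (hA ▸ Finset.card_le_card Finset.inter_subset_left) fun h => hne ?_
  have e1 := Finset.eq_of_subset_of_card_le (Finset.inter_subset_left (s₁ := A) (s₂ := B))
    (by omega)
  have e2 := Finset.eq_of_subset_of_card_le (Finset.inter_subset_right (s₁ := A) (s₂ := B))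
    (by omega)
  exact e1.symm.trans e2

section

variable {V W ι ι' : Type*} [Fintype V] [Fintype W] [DecidableEq V] [DecidableEq W]
  [DecidableEq ι] [DecidableEq ι']

theorem mem_pairUp {k l : ℕ} {f : Finset V → ι} {g : Finset W → ι} {S : Finset (V ⊕ W)} :
    S ∈ pairUp k l f g ↔ S.toLeft.card = k ∧ S.toRight.card = l ∧ f S.toLeft = g S.toRight := by
  simp only [pairUp, Finset.mem_image, Finset.mem_filter, Finset.mem_product,
    Finset.mem_powersetCard, Finset.subset_univ, true_and]
  constructor
  · rintro ⟨⟨A, B⟩, ⟨⟨h1, h2⟩, h3⟩, rfl⟩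
    simpa using ⟨h1, h2, h3⟩
  · rintro ⟨h1, h2, h3⟩
    exact ⟨(S.toLeft, S.toRight), ⟨⟨h1, h2⟩, h3⟩, Finset.toLeft_disjSum_toRight⟩

theorem card_pairUp [Fintype ι] (k l : ℕ) (f : Finset V → ι) (g : Finset W → ι) :
    (pairUp k l f g).card = ∑ i,
      ((Finset.powersetCard k Finset.univ).filter fun A => f A = i).card *
      ((Finset.powersetCard l Finset.univ).filter fun B => g B = i).card := by
  rw [pairUp, Finset.card_image_of_injective]
  · rw [Finset.card_eq_sum_card_fiberwise (f := fun p => f p.1) (t := Finset.univ) (by simp)]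
    refine Finset.sum_congr rfl fun i _ => ?_
    rw [← Finset.card_product]
    congr 1
    ext ⟨A, B⟩
    simp only [Finset.mem_filter, Finset.mem_product]
    constructor
    · rintro ⟨⟨⟨h1, h2⟩, h3⟩, h4⟩
      exact ⟨⟨h1, h4⟩, h2, h3 ▸ h4⟩
    · rintro ⟨⟨h1, h4⟩, h2, h3⟩
      exact ⟨⟨⟨h1, h2⟩, h4.trans h3.symm⟩, h4⟩
  · rintro ⟨A, B⟩ ⟨A', B'⟩ h
    have h1 := congrArg Finset.toLeft h
    have h2 := congrArg Finset.toRight h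
    simp only [Finset.toLeft_disjSum, Finset.toRight_disjSum] at h1 h2
    rw [h1, h2]

/-- If both halves differ, each intersection loses at least one point. If one half agrees, the other
halves have the same colour and differ, so properness makes them lose two. -/
theorem card_inter_lt_of_mem_pairUp {k l : ℕ} {f : Finset V → ι} {g : Finset W → ι}
    (hf : IsProperColouring k f) (hg : IsProperColouring l g) {S S' : Finset (V ⊕ W)}
    (hS : S ∈ pairUp k l f g) (hS' : S' ∈ pairUp k l f g) (hne : S ≠ S') :
    (S ∩ S').card + 2 ≤ k + l := by
  obtain ⟨h1, h2, h3⟩ := mem_pairUp.1 hS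
  obtain ⟨h1', h2', h3'⟩ := mem_pairUp.1 hS'
  rw [card_inter_eq_toLeft_add_toRight]
  have hl : (S.toLeft ∩ S'.toLeft).card ≤ k := h1 ▸ Finset.card_le_card Finset.inter_subset_left
  have hr : (S.toRight ∩ S'.toRight).card ≤ l := h2 ▸ Finset.card_le_card Finset.inter_subset_left
  by_cases hL : S.toLeft = S'.toLeft
  · have hR : S.toRight ≠ S'.toRight := fun hR => hne (by
      rw [← S.toLeft_disjSum_toRight, hL, hR, S'.toLeft_disjSum_toRight])
    have := hg.card_inter h2 h2' (by rw [← h3, ← h3', hL]) hR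
    omega
  · by_cases hR : S.toRight = S'.toRight
    · have := hf.card_inter h1 h1' (by rw [h3, h3', hR]) hL
      omega
    · have := card_inter_lt_of_ne h1 h1' hL
      have := card_inter_lt_of_ne h2 h2' hR
      omega

theorem card_inter_le_of_mem_pairUp {k l k' l' : ℕ} {f : Finset V → ι} {g : Finset W → ι}
    {f' : Finset V → ι'} {g' : Finset W → ι'} {S S' : Finset (V ⊕ W)}
    (hS : S ∈ pairUp k l f g) (hS' : S' ∈ pairUp k' l' f' g') :
    (S ∩ S').card ≤ min k k' + min l l' := by
  obtain ⟨h1, h2, -⟩ := mem_pairUp.1 hS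
  obtain ⟨h1', h2', -⟩ := mem_pairUp.1 hS'
  rw [card_inter_eq_toLeft_add_toRight]
  refine add_le_add (le_min ?_ ?_) (le_min ?_ ?_)
  · exact h1 ▸ Finset.card_le_card Finset.inter_subset_left
  · exact h1' ▸ Finset.card_le_card Finset.inter_subset_right
  · exact h2 ▸ Finset.card_le_card Finset.inter_subset_left
  · exact h2' ▸ Finset.card_le_card Finset.inter_subset_right

end

/-! ### A packing of sextuples -/

/-- The colour of a triple with `0 ≤ x < 7` identified with the residues modulo `7`, in terms of
the sums `s` and `t` of these elements and of their squares, and of the sum `e` of the weights `1`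
of `7` and `2` of `8`. -/
def tripleColourAux (s t e : ℕ) : ℕ :=
  match e with
  | 0 => 5 * s % 7
  | 1 => (4 * s + 6 * (2 * t + 6 * s ^ 2) ^ 2) % 7
  | 2 => (4 * s + (2 * t + 6 * s ^ 2) ^ 2) % 7
  | _ => s % 7

/-- The sum over `A` of the entries of a table. -/
def tableSum (l : List ℕ) (A : Finset (Fin 9)) : ℕ := ∑ x ∈ A, l.getD x 0

/-- A colouring of the triples of nine points whose classes are a large set of Steiner triple
systems. -/
def tripleColour (A : Finset (Fin 9)) : Fin 7 :=
  Fin.ofNat 7 (tripleColourAux (tableSum [0, 1, 2, 3, 4, 5, 6] A)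
    (tableSum [0, 1, 4, 9, 16, 25, 36] A) (tableSum [0, 0, 0, 0, 0, 0, 0, 1, 2] A))

theorem isProperColouring_tripleColour : IsProperColouring 3 tripleColour := by
  -- Properness is a finite check over the common pair and the two added points.
  have key : ∀ x y : Fin 9, x ≠ y → ∀ a b : Fin 9, a ≠ x ∧ a ≠ y → b ≠ x ∧ b ≠ y → a ≠ b →
      tripleColour {a, x, y} ≠ tripleColour {b, x, y} := by
    decide +kernel
  intro C a b hC ha hb h
  obtain ⟨x, y, hxy, rfl⟩ := Finset.card_eq_two.1 (show C.card = 2 by omega)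
  by_contra hab
  simp only [Finset.mem_insert, Finset.mem_singleton, not_or] at ha hb
  exact key x y hxy a b ha hb hab h

theorem card_tripleColour_eq : ∀ i : Fin 7,
    ((Finset.powersetCard 3 Finset.univ).filter fun A => tripleColour A = i).card = 12 := by
  decide +kernel

/-- Two triples of the same colour, or a quintuple and its sum modulo `9`. -/
def sextuples : Finset (Finset (Fin 9 ⊕ Fin 9)) :=
  pairUp 3 3 tripleColour tripleColour ∪
    (pairUp 1 5 (residueSum 9) (residueSum 9) ∪
      pairUp 5 1 (residueSum 9) (residueSum 9))

theorem card_filter_residueSum_one (n : ℕ) [NeZero n] (i : Fin n) :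
    ((Finset.powersetCard 1 Finset.univ).filter fun A : Finset (Fin n) => residueSum n A = i).card =
      1 := by
  rw [Finset.card_eq_one]
  refine ⟨{i}, ?_⟩
  ext A
  simp only [Finset.mem_filter, Finset.mem_powersetCard, Finset.subset_univ, true_and,
    Finset.mem_singleton, Finset.card_eq_one]
  constructor
  · rintro ⟨⟨x, rfl⟩, h⟩
    rw [← h, residueSum, Finset.sum_singleton]
  · rintro rfl
    exact ⟨⟨i, rfl⟩, Finset.sum_singleton _ _⟩

theorem sum_card_filter_residueSum (n k : ℕ) [NeZero n] :
    ∑ i : Fin n, ((Finset.powersetCard k Finset.univ).filter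
      fun A : Finset (Fin n) => residueSum n A = i).card = n.choose k := by
  rw [← Finset.card_eq_sum_card_fiberwise (by simp), Finset.card_powersetCard, Finset.card_univ,
    Fintype.card_fin]

/-- Seven colours with twelve triples on either side give `7 * 12 ^ 2 = 1008`. Each quintuple has
exactly one singleton of its colour, so the other two families have `9.choose 5 = 126` members each.
-/
theorem card_sextuples : sextuples.card = 1260 := by
  rw [sextuples, Finset.card_union_of_disjoint, Finset.card_union_of_disjoint, card_pairUp,
    card_pairUp, card_pairUp]
  · simp only [card_filter_residueSum_one, card_tripleColour_eq, one_mul, mul_one,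
      sum_card_filter_residueSum]
    simp [Nat.choose]
  · refine Finset.disjoint_left.2 fun S h h' => ?_
    have := (mem_pairUp.1 h).1
    have := (mem_pairUp.1 h').1
    omega
  · refine Finset.disjoint_left.2 fun S h h' => ?_
    have := (mem_pairUp.1 h).1
    rcases Finset.mem_union.1 h' with h' | h' <;>
    · have := (mem_pairUp.1 h').1
      omega

/-- Within a family the colourings give at most `6 - 2` common points; across families the split of
the sizes alone gives at most `1 + 3` or `1 + 1`. -/
theorem card_inter_lt_of_mem_sextuples {S S' : Finset (Fin 9 ⊕ Fin 9)} (hS : S ∈ sextuples)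
    (hS' : S' ∈ sextuples) (hne : S ≠ S') : (S ∩ S').card < 5 := by
  have h33 := isProperColouring_tripleColour
  have h1 := isProperColouring_residueSum 9 1
  have h5 := isProperColouring_residueSum 9 5
  simp only [sextuples, Finset.mem_union] at hS hS'
  rcases hS with hS | hS | hS <;> rcases hS' with hS' | hS' | hS'
  · have := card_inter_lt_of_mem_pairUp h33 h33 hS hS' hne; omega
  · have := card_inter_le_of_mem_pairUp hS hS'; omega
  · have := card_inter_le_of_mem_pairUp hS hS'; omega
  · have := card_inter_le_of_mem_pairUp hS hS'; omega
  · have := card_inter_lt_of_mem_pairUp h1 h5 hS hS' hne; omega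
  · have := card_inter_le_of_mem_pairUp hS hS'; omega
  · have := card_inter_le_of_mem_pairUp hS hS'; omega
  · have := card_inter_le_of_mem_pairUp hS hS'; omega
  · have := card_inter_lt_of_mem_pairUp h5 h1 hS hS' hne; omega

theorem card_of_mem_sextuples {S : Finset (Fin 9 ⊕ Fin 9)} (hS : S ∈ sextuples) : S.card = 6 := by
  rw [← Finset.card_toLeft_add_card_toRight]
  simp only [sextuples, Finset.mem_union, mem_pairUp] at hS
  omega

theorem isPacking_sextuples : IsPacking 5 1260
    (sextuples.map
      (Finset.mapEmbedding (finSumFinEquiv (m := 9) (n := 9)).toEmbedding).toEmbedding) := by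
  refine ⟨by rw [Finset.card_map, card_sextuples], ?_, ?_⟩
  · intro S hS
    obtain ⟨T, hT, rfl⟩ := Finset.mem_map.1 hS
    simpa using card_of_mem_sextuples hT
  · intro S hS S' hS' hne
    obtain ⟨T, hT, rfl⟩ := Finset.mem_map.1 hS
    obtain ⟨T', hT', rfl⟩ := Finset.mem_map.1 hS'
    simp only [RelEmbedding.coe_toEmbedding, Finset.mapEmbedding_apply, ← Finset.map_inter,
      Finset.card_map]
    exact card_inter_lt_of_mem_sextuples hT hT' fun h => hne (h ▸ rfl)

/-- The merging procedure can be carried out. -/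
theorem exists_mergeRun_mergeWord : ∃ P, MergeRun 18 mergeWord 0 0 P :=
  ⟨_, .row <| .col <| .rowMerge _ isPacking_pairs <| .colMerge _ isPacking_pairs <|
    .rowMerge _ isPacking_quadruples <| .colMerge _ isPacking_quadruples <|
    .rowMerge _ isPacking_sextuples <| .colMerge _ isPacking_sextuples <|
    .row <| .col <| .row <| .col <| .row <| .nil _ _⟩

/-! ### Numerical estimates of volumes -/

/-- A row of a table of rectangles: `mult` rectangles have `rows` rows and `cols` columns, and
`half` and `skew` are `10 ^ 6` times upper estimates of their `1 / 2`- and `6 / 11`-volume. -/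
structure RectangleCount where
  mult : ℕ
  rows : ℕ
  cols : ℕ
  half : ℕ
  skew : ℕ

/-- The rectangles of any output of the merging procedure on `mergeWord`. -/
def mergeTable : List RectangleCount :=
  [⟨1, 1, 262144, 512000000, 290384006⟩,
   ⟨1, 262143, 1, 511999024, 902747567⟩,
   ⟨9, 3, 65535, 443401624, 281549010⟩,
   ⟨144, 1, 65535, 255998047, 154634377⟩,
   ⟨18, 1, 65536, 256000000, 154635449⟩,
   ⟨9, 65399, 3, 442941306, 697506803⟩,
   ⟨144, 65399, 1, 255732282, 423326202⟩,
   ⟨18, 65519, 1, 255966795, 423749711⟩,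
   ⟨198, 5, 16278, 285289327, 197524276⟩,
   ⟨2862, 1, 16278, 127585266, 82103962⟩,
   ⟨24, 1, 32647, 180684809, 112654086⟩,
   ⟨792, 1, 16369, 127941393, 82312277⟩,
   ⟨198, 14913, 5, 273065927, 392829097⟩,
   ⟨2862, 14913, 1, 122118795, 189012276⟩,
   ⟨24, 30827, 1, 175576195, 280871687⟩,
   ⟨792, 15914, 1, 126150704, 195830191⟩,
   ⟨1260, 7, 3302, 152032892, 114922930⟩,
   ⟨17304, 1, 3302, 57463032, 39759794⟩,
   ⟨1008, 1, 7099, 84255564, 56304639⟩,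
   ⟨7560, 1, 3797, 61619803, 42366097⟩,
   ⟨1260, 1586, 7, 105366029, 134820332⟩,
   ⟨17304, 1586, 1, 39824616, 55669833⟩,
   ⟨1008, 4096, 1, 64000000, 93406727⟩,
   ⟨7560, 2510, 1, 50099901, 71510117⟩,
   ⟨31824, 1, 562, 23706540, 17777888⟩,
   ⟨31824, 232, 1, 15231547, 19510401⟩,
   ⟨43758, 1, 56, 7483315, 6232050⟩,
   ⟨43758, 11, 1, 3316625, 3698558⟩,
   ⟨48620, 1, 1, 1000000, 1000000⟩]

theorem upperCount_values :
    upperCount 18 0 = 262144 ∧ upperCount 18 1 = 262143 ∧ upperCount 17 1 = 131071 ∧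
    upperCount 16 1 = 65535 ∧ upperCount 17 3 = 130918 ∧ upperCount 16 3 = 65399 ∧
    upperCount 15 3 = 32647 ∧ upperCount 14 3 = 16278 ∧ upperCount 15 5 = 30827 ∧
    upperCount 14 5 = 14913 ∧ upperCount 13 5 = 7099 ∧ upperCount 12 5 = 3302 ∧
    upperCount 13 7 = 4096 ∧ upperCount 12 7 = 1586 ∧ upperCount 11 7 = 562 ∧
    upperCount 11 8 = 232 ∧ upperCount 10 8 = 56 ∧ upperCount 10 9 = 11 ∧
    upperCount 9 9 = 1 := by
  decide +kernel

theorem wordVolume_mergeWord (α : ℝ) :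
    wordVolume 18 mergeWord 0 0 α =
      (mergeTable.map fun t => t.mult * rectVolume α t.rows t.cols).sum := by
  have hc : Nat.choose 18 0 = 1 ∧ Nat.choose 18 1 = 18 ∧ Nat.choose 18 2 = 153 ∧
      Nat.choose 18 3 = 816 ∧ Nat.choose 18 4 = 3060 ∧ Nat.choose 18 5 = 8568 ∧
      Nat.choose 18 6 = 18564 ∧ Nat.choose 18 7 = 31824 ∧ Nat.choose 18 8 = 43758 ∧
      Nat.choose 18 9 = 48620 := by decide +kernel
  simp only [mergeWord, wordVolume, rowVolume, rowMergeVolume, rectVolume_one_sub, zero_add,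
    Nat.reduceAdd, Nat.reduceSub, Nat.reduceMul, upperCount_values, hc, mergeTable, List.map_cons,
    List.map_nil, List.sum_cons, List.sum_nil]
  -- The table omits the unmerged singletons at the first merging steps: `18 - 9 * 2 = 0`, as the
  -- nine pairs cover all points.
  push_cast
  ring

/-- For a rational weight the `n`-th power is an integer, so the decimal estimates reduce to integer
inequalities. -/
theorem rectVolume_pow {a b n : ℕ} (hn : 0 < n) (hab : a + b = n) (i j : ℕ) :
    rectVolume (a / n) i j ^ n = (i : ℝ) ^ a * (j : ℝ) ^ b := by
  have hn0 : (n : ℝ) ≠ 0 := by exact_mod_cast hn.ne'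
  have h1 : (1 : ℝ) - a / n = b / n := by
    rw [eq_div_iff hn0, sub_mul, div_mul_cancel₀ _ hn0, ← hab]
    push_cast
    ring
  rw [rectVolume, h1, mul_pow, ← Real.rpow_natCast, ← Real.rpow_natCast _ n, ← Real.rpow_mul
    (Nat.cast_nonneg _), ← Real.rpow_mul (Nat.cast_nonneg _), div_mul_cancel₀ _ hn0,
    div_mul_cancel₀ _ hn0, Real.rpow_natCast, Real.rpow_natCast]

theorem rectVolume_le {a b n s : ℕ} (hn : 0 < n) (hab : a + b = n) (hs : 0 < s) {i j u : ℕ}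
    (h : i ^ a * j ^ b * s ^ n ≤ u ^ n) : rectVolume (a / n) i j ≤ u / s := by
  refine le_of_pow_le_pow_left₀ hn.ne' (by positivity) ?_
  rw [rectVolume_pow hn hab, div_pow, le_div_iff₀ (by positivity)]
  exact_mod_cast h

theorem le_rectVolume {a b n s : ℕ} (hn : 0 < n) (hab : a + b = n) (hs : 0 < s) {i j u : ℕ}
    (h : u ^ n ≤ i ^ a * j ^ b * s ^ n) : u / s ≤ rectVolume (a / n) i j := by
  refine le_of_pow_le_pow_left₀ hn.ne' (by unfold rectVolume; positivity) ?_
  rw [rectVolume_pow hn hab, div_pow, div_le_iff₀ (by positivity)]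
  exact_mod_cast h

theorem list_sum_le_of_forall_le {ι : Type*} (l : List ι) (m u : ι → ℕ) (f : ι → ℝ) (s : ℕ)
    (h : ∀ t ∈ l, f t ≤ (u t : ℝ) / s) :
    (l.map fun t => m t * f t).sum ≤ ((l.map fun t => m t * u t).sum : ℕ) / (s : ℝ) := by
  induction l with
  | nil => simp
  | cons t l ih =>
    have h1 := ih fun t' ht' => h t' (List.mem_cons_of_mem _ ht')
    have h2 := mul_le_mul_of_nonneg_left (h t List.mem_cons_self) (Nat.cast_nonneg (α := ℝ) (m t))
    simp only [List.map_cons, List.sum_cons]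
    push_cast
    rw [add_div, mul_div_assoc]
    push_cast at h1
    linarith

theorem le_list_sum_of_forall_le {ι : Type*} (l : List ι) (m u : ι → ℕ) (f : ι → ℝ) (s : ℕ)
    (h : ∀ t ∈ l, (u t : ℝ) / s ≤ f t) :
    ((l.map fun t => m t * u t).sum : ℕ) / (s : ℝ) ≤ (l.map fun t => m t * f t).sum := by
  induction l with
  | nil => simp
  | cons t l ih =>
    have h1 := ih fun t' ht' => h t' (List.mem_cons_of_mem _ ht')
    have h2 := mul_le_mul_of_nonneg_left (h t List.mem_cons_self) (Nat.cast_nonneg (α := ℝ) (m t))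
    simp only [List.map_cons, List.sum_cons]
    push_cast
    rw [add_div, mul_div_assoc]
    push_cast at h1
    linarith

theorem wordVolume_mergeWord_half_lt : wordVolume 18 mergeWord 0 0 (1 / 2) < 5889105 := by
  rw [wordVolume_mergeWord]
  have hcheck : ∀ t ∈ mergeTable, t.rows ^ 1 * t.cols ^ 1 * (10 ^ 6) ^ 2 ≤ t.half ^ 2 := by
    decide +kernel
  refine (list_sum_le_of_forall_le mergeTable RectangleCount.mult RectangleCount.half _ (10 ^ 6)
    fun t ht => by
      have := rectVolume_le (a := 1) (b := 1) (by norm_num) rfl (by norm_num) (hcheck t ht)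
      simpa using this).trans_lt ?_
  have hsum : (mergeTable.map fun t => t.mult * t.half).sum < 5889105 * 10 ^ 6 := by
    decide +kernel
  rw [div_lt_iff₀ (by norm_num)]
  exact_mod_cast hsum

/-- The threshold 5889000 separates the `1 / 2`-volume from the volumes used at the other weights.
-/
theorem lt_wordVolume_mergeWord_half : 5889000 < wordVolume 18 mergeWord 0 0 (1 / 2) := by
  rw [wordVolume_mergeWord]
  -- The table entries are rounded up, so subtracting one unit gives lower estimates.
  have hcheck : ∀ t ∈ mergeTable, (t.half - 1) ^ 2 ≤ t.rows ^ 1 * t.cols ^ 1 * (10 ^ 6) ^ 2 := by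
    decide +kernel
  refine lt_of_lt_of_le ?_ (le_list_sum_of_forall_le mergeTable RectangleCount.mult
    (fun t => t.half - 1) _ (10 ^ 6) fun t ht => by
      have := le_rectVolume (a := 1) (b := 1) (by norm_num) rfl (by norm_num) (hcheck t ht)
      simpa using this)
  have hsum : 5889000 * 10 ^ 6 < (mergeTable.map fun t => t.mult * (t.half - 1)).sum := by
    decide +kernel
  rw [lt_div_iff₀ (by norm_num)]
  exact_mod_cast hsum

/-- The weight `6 / 11` is the crossover: both the merged output and the partitioning into rows are
below the threshold there. -/
theorem wordVolume_mergeWord_skew_lt : wordVolume 18 mergeWord 0 0 (6 / 11) < 5889000 := by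
  rw [wordVolume_mergeWord]
  have hcheck : ∀ t ∈ mergeTable, t.rows ^ 6 * t.cols ^ 5 * (10 ^ 6) ^ 11 ≤ t.skew ^ 11 := by
    decide +kernel
  refine (list_sum_le_of_forall_le mergeTable RectangleCount.mult RectangleCount.skew _ (10 ^ 6)
    fun t ht => by
      have := rectVolume_le (a := 6) (b := 5) (by norm_num) rfl (by norm_num) (hcheck t ht)
      simpa using this).trans_lt ?_
  have hsum : (mergeTable.map fun t => t.mult * t.skew).sum < 5889000 * 10 ^ 6 := by
    decide +kernel
  rw [div_lt_iff₀ (by norm_num)]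
  exact_mod_cast hsum

theorem rpow_wordVolume_mergeWord_lt :
    wordVolume 18 mergeWord 0 0 (1 / 2) ^ (1 / 18 : ℝ) < (2 : ℝ) ^ (1.249424 : ℝ) := by
  have h1 := wordVolume_mergeWord_half_lt
  have h0 : (0 : ℝ) < wordVolume 18 mergeWord 0 0 (1 / 2) :=
    lt_trans (by norm_num) lt_wordVolume_mergeWord_half
  -- The fraction `5420 / 241` lies just below `18 * 1.249424` and turns the comparison into one
  -- between integer powers.
  have h2 : (5889105 : ℝ) < 2 ^ (5420 / 241 : ℝ) := by
    refine lt_of_pow_lt_pow_left₀ 241 (by positivity) ?_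
    rw [← Real.rpow_natCast (2 ^ _), ← Real.rpow_mul (by norm_num)]
    rw [show (5420 / 241 : ℝ) * (241 : ℕ) = (5420 : ℕ) by norm_num, Real.rpow_natCast]
    have : (5889105 : ℕ) ^ 241 < 2 ^ 5420 := by decide +kernel
    exact_mod_cast this
  calc wordVolume 18 mergeWord 0 0 (1 / 2) ^ (1 / 18 : ℝ)
      < (2 ^ (5420 / 241 : ℝ)) ^ (1 / 18 : ℝ) := by
        refine Real.rpow_lt_rpow h0.le (h1.trans h2) (by norm_num)
    _ = (2 : ℝ) ^ (5420 / 241 * (1 / 18) : ℝ) := by rw [← Real.rpow_mul (by norm_num)]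
    _ ≤ _ := by
        refine Real.rpow_le_rpow_of_exponent_le (by norm_num) ?_
        norm_num

/-! ### The partitioning into rows -/

theorem upperCount_zero (n : ℕ) : upperCount n 0 = 2 ^ n := by
  rw [upperCount, ← Nat.sum_range_choose, ← Nat.range_succ_eq_Icc_zero]

theorem mergeRun_replicate_row (d n r : ℕ) :
    ∃ P, MergeRun d (List.replicate n .row) r 0 P := by
  induction n generalizing r with
  | zero => exact ⟨_, .nil _ _⟩
  | succ n ih =>
    obtain ⟨P, hP⟩ := ih (r + 1)
    exact ⟨_, .row hP⟩

theorem wordVolume_replicate_row (d n r : ℕ) (α : ℝ) :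
    wordVolume d (List.replicate n .row) r 0 α =
      ∑ j ∈ Finset.range n, rowVolume d (r + j) 0 α := by
  induction n generalizing r with
  | zero => rfl
  | succ n ih =>
    rw [List.replicate_succ, wordVolume, ih, Finset.sum_range_succ', add_comm]
    congr 1
    exact Finset.sum_congr rfl fun j _ => by rw [add_assoc, add_comm 1 j]

/-- A row of size `j` has `2 ^ (d - j)` columns, and the binomial theorem sums the volumes. The `d +
1` letters handle the sizes `0, …, d`. -/
theorem wordVolume_replicate_row_succ (d : ℕ) (α : ℝ) :
    wordVolume d (List.replicate (d + 1) .row) 0 0 α = (1 + (2 : ℝ) ^ (1 - α)) ^ d := by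
  rw [wordVolume_replicate_row, add_pow]
  refine Finset.sum_congr rfl fun j _ => ?_
  rw [rowVolume, rectVolume, zero_add, upperCount_zero]
  push_cast
  rw [Real.one_rpow, one_pow, ← Real.rpow_natCast, ← Real.rpow_natCast (_ ^ _),
    ← Real.rpow_mul (by norm_num), ← Real.rpow_mul (by norm_num), mul_comm (1 - α)]
  ring

theorem rowsRead_replicate_row (n : ℕ) : rowsRead (List.replicate n .row) = n := by
  induction n with
  | zero => rfl
  | succ n ih => rw [List.replicate_succ, rowsRead, ih]

theorem one_add_two_rpow_lt {β : ℝ} (hβ : β ≤ 5 / 11) : (1 + (2 : ℝ) ^ β) ^ 18 < 5889000 := by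
  have h1 : (2 : ℝ) ^ β ≤ 1.371 := by
    refine (Real.rpow_le_rpow_of_exponent_le (by norm_num) hβ).trans ?_
    refine le_of_pow_le_pow_left₀ (n := 11) (by norm_num) (by norm_num) ?_
    rw [← Real.rpow_natCast, ← Real.rpow_mul (by norm_num)]
    rw [show (5 / 11 : ℝ) * (11 : ℕ) = (5 : ℕ) by norm_num, Real.rpow_natCast]
    norm_num
  calc (1 + (2 : ℝ) ^ β) ^ 18 ≤ (1 + 1.371) ^ 18 := by gcongr
    _ < 5889000 := by norm_num

/-! ### From outputs to partitionings into nonempty rectangles -/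

section

variable {I J : Type*} [DecidableEq I] [DecidableEq J]

theorem IsPartitioning.swap {M : Matrix I J ℕ} {P : Multiset (Rectangle I J)}
    (hP : IsPartitioning P M) : IsPartitioning (swapRects P) M.transpose := by
  intro j i
  rw [Matrix.transpose_apply, ← hP i j]
  exact coverCount_swapRects P i j

/-- Empty rectangles cover nothing. They are removed because the potential estimate needs side
lengths at least 1 and convexity needs positive ones. -/
theorem IsPartitioning.filter_nonempty {M : Matrix I J ℕ} {P : Multiset (Rectangle I J)}
    (hP : IsPartitioning P M) :
    IsPartitioning (P.filter fun Q => Q.1.Nonempty ∧ Q.2.Nonempty) M := by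
  intro i j
  rw [← hP i j]
  clear hP
  induction P using Multiset.induction_on with
  | empty => rfl
  | cons Q P ih =>
    by_cases hQ : Q.1.Nonempty ∧ Q.2.Nonempty
    · rw [Multiset.filter_cons_of_pos (p := fun Q => Q.1.Nonempty ∧ Q.2.Nonempty) P hQ,
        Multiset.map_cons, Multiset.map_cons,
        Multiset.sum_cons, Multiset.sum_cons, ih]
    · rw [Multiset.filter_cons_of_neg (p := fun Q => Q.1.Nonempty ∧ Q.2.Nonempty) P hQ,
        Multiset.map_cons, Multiset.sum_cons, ih,
        if_neg fun h => hQ ⟨⟨i, h.1⟩, ⟨j, h.2⟩⟩, zero_add]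

theorem IsPartitioning.reindex {I' J' : Type*} [DecidableEq I'] [DecidableEq J']
    {M : Matrix I' J' ℕ} (e : I ≃ I') (f : J ≃ J') {P : Multiset (Rectangle I J)}
    (hP : IsPartitioning P (M.submatrix e f)) :
    IsPartitioning (P.map fun Q => (Q.1.map e.toEmbedding, Q.2.map f.toEmbedding)) M := by
  intro i j
  have := hP (e.symm i) (f.symm j)
  rw [Matrix.submatrix_apply, e.apply_symm_apply, f.apply_symm_apply] at this
  rw [← this, Multiset.map_map]
  simp only [Function.comp_apply, Finset.mem_map_equiv]

end

theorem alphaVolume_le_of_le {I J : Type*} {P P' : Multiset (Rectangle I J)} (h : P ≤ P') (α : ℝ) :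
    alphaVolume P α ≤ alphaVolume P' α := by
  obtain ⟨P'', rfl⟩ := Multiset.le_iff_exists_add.1 h
  rw [alphaVolume_add]
  refine le_add_of_nonneg_right (Multiset.sum_nonneg ?_)
  intro x hx
  obtain ⟨Q, -, rfl⟩ := Multiset.mem_map.1 hx
  positivity

theorem alphaVolume_map_equiv {I J I' J' : Type*} (e : I ≃ I') (f : J ≃ J')
    (P : Multiset (Rectangle I J)) (α : ℝ) :
    alphaVolume (P.map fun Q => (Q.1.map e.toEmbedding, Q.2.map f.toEmbedding)) α =
      alphaVolume P α := by
  simp [alphaVolume]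

/-- The volume of a family of nonempty rectangles is a convex function of `α`. -/
theorem alphaVolume_convex {I J : Type*} {P : Multiset (Rectangle I J)}
    (hP : ∀ Q ∈ P, Q.1.Nonempty ∧ Q.2.Nonempty) {s t a b : ℝ} (hs : 0 ≤ s) (ht : 0 ≤ t)
    (hst : s + t = 1) :
    alphaVolume P (s * a + t * b) ≤ s * alphaVolume P a + t * alphaVolume P b := by
  simp only [alphaVolume]
  rw [← Multiset.sum_map_mul_left, ← Multiset.sum_map_mul_left, ← Multiset.sum_map_add]
  refine Multiset.sum_map_le_sum_map _ _ fun Q hQ => ?_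
  have hx : (0 : ℝ) < Q.1.card := by exact_mod_cast (hP Q hQ).1.card_pos
  have hy : (0 : ℝ) < Q.2.card := by exact_mod_cast (hP Q hQ).2.card_pos
  refine le_trans (le_of_eq ?_) (Real.geom_mean_le_arith_mean2_weighted hs ht
    (p₁ := (Q.1.card : ℝ) ^ a * (Q.2.card : ℝ) ^ (1 - a))
    (p₂ := (Q.1.card : ℝ) ^ b * (Q.2.card : ℝ) ^ (1 - b)) (by positivity) (by positivity) hst)
  rw [Real.mul_rpow (by positivity) (by positivity), Real.mul_rpow (by positivity) (by positivity),
    ← Real.rpow_mul hx.le, ← Real.rpow_mul hx.le, ← Real.rpow_mul hy.le, ← Real.rpow_mul hy.le,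
    mul_mul_mul_comm, ← Real.rpow_add hx, ← Real.rpow_add hy]
  congr 2
  · ring
  · linear_combination -hst

/-- The bijection between the subsets and the `0/1`-vectors. -/
def indicatorEquiv (d : ℕ) : Finset (Fin d) ≃ (Fin d → Fin 2) where
  toFun := indicatorTuple
  invFun v := Finset.univ.filter fun t => v t = 1
  left_inv S := by
    ext t
    by_cases h : t ∈ S <;> simp [indicatorTuple, h]
  right_inv v := by
    ext t
    rcases Fin.exists_fin_two.1 ⟨v t, rfl⟩ with h | h <;> simp [indicatorTuple, h]

theorem disjointnessMatrix_transpose_kroneckerPower (d : ℕ) :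
    (kroneckerPower (disjointnessMatrix ℕ) d).transpose =
      kroneckerPower (disjointnessMatrix ℕ) d := by
  ext i j
  simp only [Matrix.transpose_apply, kroneckerPower, Matrix.of_apply]
  refine Finset.prod_congr rfl fun t _ => ?_
  generalize i t = x
  generalize j t = y
  fin_cases x <;> fin_cases y <;> rfl

theorem MergeRun.exists_isPartitioning {d : ℕ} {w : List Letter}
    {P : Multiset (Rectangle (Finset (Fin d)) (Finset (Fin d)))} (h : MergeRun d w 0 0 P)
    (hw : d < rowsRead w + colsRead w) :
    ∃ P', IsPartitioning P' (kroneckerPower (disjointnessMatrix ℕ) d) ∧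
      (∀ Q ∈ P', Q.1.Nonempty ∧ Q.2.Nonempty) ∧ ∀ α, alphaVolume P' α ≤ wordVolume d w 0 0 α := by
  refine ⟨_, ((h.isPartitioning hw).reindex (indicatorEquiv d) (indicatorEquiv d)).filter_nonempty,
    fun Q hQ => (Multiset.mem_filter.1 hQ).2, fun α => ?_⟩
  refine (alphaVolume_le_of_le (Multiset.filter_le _ _) α).trans ?_
  rw [alphaVolume_map_equiv, h.alphaVolume_eq]

/-- For every weight the output or its transpose or a partitioning into rows or columns has volume
at most the `1 / 2`-volume of the output. -/
theorem exists_isPartitioning_alphaVolume_le_half (p : ℝ) (hp0 : 0 ≤ p) (hp1 : p ≤ 1) :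
    ∃ P, IsPartitioning P (kroneckerPower (disjointnessMatrix ℕ) 18) ∧
      (∀ Q ∈ P, Q.1.Nonempty ∧ Q.2.Nonempty) ∧
      alphaVolume P p ≤ wordVolume 18 mergeWord 0 0 (1 / 2) := by
  have hV := lt_wordVolume_mergeWord_half
  -- Exchanging rows and columns turns weight `p` into `1 - p`, and the matrix is symmetric.
  wlog hp : 1 / 2 ≤ p generalizing p
  · obtain ⟨P, hP, hne, hs⟩ := this (1 - p) (by linarith) (by linarith) (by linarith)
    refine ⟨swapRects P, ?_, ?_, by rwa [alphaVolume_swapRects]⟩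
    · rw [← disjointnessMatrix_transpose_kroneckerPower]
      exact hP.swap
    · intro Q hQ
      obtain ⟨Q, hQ', rfl⟩ := Multiset.mem_map.1 hQ
      exact (hne Q hQ').symm
  rcases le_total p (6 / 11) with hp' | hp'
  · obtain ⟨P, hP⟩ := exists_mergeRun_mergeWord
    obtain ⟨P', hP', hne, hs⟩ := hP.exists_isPartitioning (by decide)
    refine ⟨P', hP', hne, ?_⟩
    -- The coefficients are the barycentric coordinates of `p` between `1 / 2` and `6 / 11`.
    have h1 := alphaVolume_convex hne (s := 12 - 22 * p) (t := 22 * p - 11) (a := 1 / 2)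
      (b := 6 / 11) (by linarith) (by linarith) (by ring)
    rw [show (12 - 22 * p) * (1 / 2) + (22 * p - 11) * (6 / 11) = p by ring] at h1
    have h2 := mul_le_mul_of_nonneg_left (hs (1 / 2)) (show 0 ≤ 12 - 22 * p by linarith)
    have h3 := mul_le_mul_of_nonneg_left
      (((hs (6 / 11)).trans wordVolume_mergeWord_skew_lt.le).trans hV.le)
      (show 0 ≤ 22 * p - 11 by linarith)
    linarith
  · obtain ⟨P, hP⟩ := mergeRun_replicate_row 18 (18 + 1) 0
    obtain ⟨P', hP', hne, hs⟩ := hP.exists_isPartitioning (by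
      rw [rowsRead_replicate_row]; omega)
    refine ⟨P', hP', hne, (hs p).trans ?_⟩
    rw [wordVolume_replicate_row_succ]
    exact (one_add_two_rpow_lt (by linarith)).le.trans hV.le

/-! ### The main theorem -/

theorem exists_isPartitioning_disjointnessMatrix (n : ℕ) :
    ∃ P, IsPartitioning P (kroneckerPower (disjointnessMatrix ℕ) n) :=
  exists_isPartitioning _ (kroneckerPower_zero_or_one (by
    intro i j; fin_cases i <;> fin_cases j <;> simp [disjointnessMatrix]) n)

theorem tendsto_sigmaPAR_disjointnessMatrix :
    Tendsto (fun n : ℕ => (sizePAR (kroneckerPower (disjointnessMatrix ℕ) n) : ℝ) ^ (1 / (n : ℝ)))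
      atTop (𝓝 (sigmaPAR (disjointnessMatrix ℕ))) :=
  tendsto_sigmaPAR exists_isPartitioning_disjointnessMatrix ⟨0, 0, by simp [disjointnessMatrix]⟩

theorem sigmaPAR_disjointnessMatrix_le :
    sigmaPAR (disjointnessMatrix ℕ) ≤ wordVolume 18 mergeWord 0 0 (1 / 2) ^ (1 / 18 : ℝ) := by
  have := sigmaPAR_le_of_forall_alphaVolume_le (d := 18) (by norm_num)
    (lt_trans (by norm_num) lt_wordVolume_mergeWord_half) tendsto_sigmaPAR_disjointnessMatrix
    exists_isPartitioning_alphaVolume_le_half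
  exact_mod_cast this

/-- A sequence whose `n`-th roots tend to less than `2 ^ β` is `O((2 ^ n) ^ β)`. -/
theorem exists_le_mul_two_pow_rpow {f : ℕ → ℕ} {l β : ℝ} (hβ : 0 ≤ β)
    (hf : Tendsto (fun n : ℕ => (f n : ℝ) ^ (1 / (n : ℝ))) atTop (𝓝 l)) (hl : l < 2 ^ β) :
    ∃ K : ℝ, 0 ≤ K ∧ ∀ n, (f n : ℝ) ≤ K * ((2 : ℝ) ^ n) ^ β := by
  obtain ⟨N, hN⟩ := eventually_atTop.1 (hf.eventually_lt_const hl)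
  -- The sum absorbs the finitely many early terms, including `n = 0`; the summand 1 serves all
  -- later ones.
  refine ⟨1 + ∑ n ∈ Finset.range (N + 1), (f n : ℝ), by positivity, fun n => ?_⟩
  have h1 : (1 : ℝ) ≤ ((2 : ℝ) ^ n) ^ β := Real.one_le_rpow (one_le_pow₀ (by norm_num)) hβ
  have h0 : (0 : ℝ) ≤ ∑ n ∈ Finset.range (N + 1), (f n : ℝ) := by positivity
  rcases lt_or_ge n (N + 1) with hn | hn
  · have h2 := Finset.single_le_sum (f := fun n => (f n : ℝ)) (fun _ _ => Nat.cast_nonneg _)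
      (Finset.mem_range.2 hn)
    nlinarith
  · have h2 := (hN n (by omega)).le
    have hn0 : (n : ℝ) ≠ 0 := by norm_cast; omega
    have h3 : (f n : ℝ) ≤ ((2 : ℝ) ^ n) ^ β := by
      calc (f n : ℝ) = ((f n : ℝ) ^ (1 / (n : ℝ))) ^ (n : ℝ) := by
            rw [← Real.rpow_mul (Nat.cast_nonneg _), one_div_mul_cancel hn0, Real.rpow_one]
        _ ≤ (2 ^ β) ^ (n : ℝ) := by gcongr
        _ = _ := by
            rw [← Real.rpow_natCast 2 n, ← Real.rpow_mul (by norm_num),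
              ← Real.rpow_mul (by norm_num), mul_comm]
    nlinarith

theorem exists_circuit_depth_two :
    ∃ K : ℝ, 0 ≤ K ∧ ∀ (F : Type u) [Field F] (k : ℕ),
      ∃ C : LinearCircuit F (Fin k → Fin 2) (Fin k → Fin 2) 2,
        C.matrix = kroneckerPower (disjointnessMatrix F) k ∧
        (C.size : ℝ) ≤ K * ((2 : ℝ) ^ k) ^ (1.249424 : ℝ) := by
  obtain ⟨K, hK0, hK⟩ := exists_le_mul_two_pow_rpow (β := 1.249424) (by norm_num)
    tendsto_sigmaPAR_disjointnessMatrix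
    (sigmaPAR_disjointnessMatrix_le.trans_lt rpow_wordVolume_mergeWord_lt)
  refine ⟨K, hK0, fun F _ k => ?_⟩
  obtain ⟨P, hP, hs⟩ :=
    exists_isPartitioning_sizePAR (exists_isPartitioning_disjointnessMatrix k)
  obtain ⟨C, hC, hCs⟩ := hP.exists_circuit (F := F)
  refine ⟨C, ?_, by rw [hCs, hs]; exact hK k⟩
  rw [hC, kroneckerPower_map, disjointnessMatrix_map]

theorem exists_circuit_depth_even (d : ℕ) (hd : 0 < d) (hd2 : Even d) :
    ∃ K : ℝ, ∀ (F : Type u) [Field F] (k : ℕ),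
      ∃ C : LinearCircuit F (Fin k → Fin 2) (Fin k → Fin 2) d,
        C.matrix = kroneckerPower (disjointnessMatrix F) k ∧
        (C.size : ℝ) ≤ K * ((2 : ℝ) ^ k) ^ (1 + 0.498848 / (d : ℝ)) := by
  obtain ⟨h, rfl⟩ : ∃ h, d = 2 * (h + 1) := by
    obtain ⟨h, rfl⟩ := hd2
    exact ⟨h - 1, by omega⟩
  obtain ⟨K, hK0, hK⟩ := exists_circuit_depth_two.{u}
  -- The factor `2 ^ 0.249424` pays for the block length `k / (h + 1) + 1`, which exceeds the real
  -- quotient by at most one. With `d = 2 * (h + 1)`, the exponent `0.249424 / (h + 1)` is `0.498848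
  -- / d`.
  refine ⟨(h + 1) * (K * 2 ^ (0.249424 : ℝ)), fun F _ k => ?_⟩
  have hK' := hK F
  rw [show (1.249424 : ℝ) = 1 + 0.249424 by norm_num] at hK'
  obtain ⟨C, hC, hs⟩ := exists_circuit_even_depth (disjointnessMatrix F) hK0 (by norm_num) hK'
    (k / (h + 1) + 1) h k (by
      rw [mul_add, mul_one]
      exact (Nat.lt_div_mul_add (Nat.succ_pos h)).le.trans_eq (by rw [mul_comm]))
  refine ⟨C, hC, hs.trans ?_⟩
  have hle : ((k / (h + 1) : ℕ) : ℝ) ≤ k / ((h : ℝ) + 1) := by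
    have := Nat.cast_div_le (α := ℝ) (m := k) (n := h + 1)
    push_cast at this
    exact this
  have hpow : ((2 : ℝ) ^ (k / (h + 1) + 1)) ^ (0.249424 : ℝ) ≤
      2 ^ (0.249424 : ℝ) * ((2 : ℝ) ^ k) ^ (0.498848 / ((2 * (h + 1) : ℕ) : ℝ)) := by
    rw [← Real.rpow_natCast, ← Real.rpow_natCast, ← Real.rpow_mul (by norm_num),
      ← Real.rpow_mul (by norm_num), ← Real.rpow_add (by norm_num)]
    refine Real.rpow_le_rpow_of_exponent_le (by norm_num) ?_
    push_cast
    have : (k : ℝ) * (0.498848 / (2 * (h + 1))) = k / (h + 1) * 0.249424 := by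
      field_simp
      ring
    rw [this]
    nlinarith
  rw [Real.rpow_add (by positivity), Real.rpow_one]
  calc ((h : ℝ) + 1) * (K * 2 ^ k * ((2 : ℝ) ^ (k / (h + 1) + 1)) ^ (0.249424 : ℝ))
      ≤ (h + 1) * (K * 2 ^ k * (2 ^ (0.249424 : ℝ) *
        ((2 : ℝ) ^ k) ^ (0.498848 / ((2 * (h + 1) : ℕ) : ℝ)))) := by gcongr
    _ = _ := by ring

theorem mainTheorem2 :
    -- the procedure can be carried out without failure
    (∃ P, MergeRun 18 mergeWord 0 0 P) ∧
    -- every output is a partitioning of the 18th power, and its volume bounds `σ_PAR`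
    (∀ P, MergeRun 18 mergeWord 0 0 P →
      IsPartitioning P
        ((kroneckerPower (disjointnessMatrix ℕ) 18).submatrix indicatorTuple indicatorTuple) ∧
      sigmaPAR (disjointnessMatrix ℕ) ≤ alphaVolume P (1 / 2) ^ (1 / 18 : ℝ) ∧
      alphaVolume P (1 / 2) ^ (1 / 18 : ℝ) < (2 : ℝ) ^ (1.249424 : ℝ)) ∧
    -- the limit defining `σ_PAR` exists
    Tendsto (fun n : ℕ => (sizePAR (kroneckerPower (disjointnessMatrix ℕ) n) : ℝ) ^ (1 / (n : ℝ)))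
      atTop (𝓝 (sigmaPAR (disjointnessMatrix ℕ))) ∧
    -- circuits of depth two
    (∃ K : ℝ, ∀ (F : Type u) [Field F] (k : ℕ),
      ∃ C : LinearCircuit F (Fin k → Fin 2) (Fin k → Fin 2) 2,
        C.matrix = kroneckerPower (disjointnessMatrix F) k ∧
        (C.size : ℝ) ≤ K * ((2 : ℝ) ^ k) ^ (1.249424 : ℝ)) ∧
    -- circuits of even depth `d`
    (∀ d : ℕ, 0 < d → Even d → ∃ K : ℝ, ∀ (F : Type u) [Field F] (k : ℕ),
      ∃ C : LinearCircuit F (Fin k → Fin 2) (Fin k → Fin 2) d,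
        C.matrix = kroneckerPower (disjointnessMatrix F) k ∧
        (C.size : ℝ) ≤ K * ((2 : ℝ) ^ k) ^ (1 + 0.498848 / (d : ℝ))) := by
  refine ⟨exists_mergeRun_mergeWord, fun P hP => ⟨hP.isPartitioning (by decide), ?_, ?_⟩,
    tendsto_sigmaPAR_disjointnessMatrix, ?_, exists_circuit_depth_even.{u}⟩
  · rw [hP.alphaVolume_eq]
    exact sigmaPAR_disjointnessMatrix_le
  · rw [hP.alphaVolume_eq]
    exact rpow_wordVolume_mergeWord_lt
  · obtain ⟨K, -, hK⟩ := exists_circuit_depth_two.{u}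
    exact ⟨K, hK⟩
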